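/- Let $\mathcal{G}\rightrightarrows M$ be a Lie groupoid: $\mathcal{G}$ and $M$ are smooth (finite-dimensional) manifolds, the source $s$, target $t$, unit map $p\mapsto e_p$, inversion and multiplication $(g,h)\mapsto gh$ (defined for $s(g)=t(h)$) are smooth, and $s$ is a surjective submersion; hence so is $t$. Let $T^t\mathcal{G}:=\ker t_*\subset T\mathcal{G}$, so that $(T^t\mathcal{G})_g=T_g\,t^{-1}(t(g))$, and let $l_g:t^{-1}(s(g))\to t^{-1}(t(g))$ be left multiplication by $g$. Let $A\mathcal{G}:=T^t\mathcal{G}|_M$ be the Lie algebroid of $\mathcal{G}\rightrightarrows M$, where $p\in M$ is identified with the unit $e_p$. For a smooth section $X\in\Gamma(A\mathcal{G})$ let $\widetilde X$ be the associated left-invariant vector field, $\widetilde X_g:=(l_g)_{*,s(g)}X_{s(g)}$. The anchor is $\rho:=s_*|_{A\mathcal{G}}$ and the bracket is $[X,Y]:=[\widetilde X,\widetilde Y]|_M$ (which again takes values in $A\mathcal{G}$). For $\omega\in\Gamma(\wedge^k(A\mathcal{G})^*)$ and $X_1,\dots,X_{k+1}\in\Gamma(A\mathcal{G})$, $$(d_{A\mathcal{G}}\omega)(X_1,\dots,X_{k+1})=\sum_{i=1}^{k+1}(-1)^{i+1}\rho(X_i)[\omega(X_1,\dots,\widehat{X}_i,\dots,X_{k+1})]+\sum_{i<j}(-1)^{i+j}\omega([X_i,X_j],X_1,\dots,\widehat{X}_i,\dots,\widehat{X}_j,\dots,X_{k+1}).$$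 A smooth section $\widetilde\omega$ of $\wedge^k(T^t\mathcal{G})^*$ restricts to a differential $k$-form $\widetilde\omega^{(p)}:=\widetilde\omega|_{t^{-1}(p)}$ on each target fibre $t^{-1}(p)$; it is called left-invariant if $(l_g)^*\widetilde\omega^{(t(g))}=\widetilde\omega^{(s(g))}$ for all $g\in\mathcal{G}$. Let $\Gamma_L(\wedge^k(T^t\mathcal{G})^*)$ be the space of left-invariant smooth sections, $k\ge 0$. Then the restriction map $$\varphi:\Gamma_L(\wedge^k(T^t\mathcal{G})^*)\to\Gamma(\wedge^k(A\mathcal{G})^*),\qquad \varphi(\widetilde\omega):=\widetilde\omega|_M,\ \text{ i.e. } \varphi(\widetilde\omega)_p=\widetilde\omega_{e_p},$$ is (well defined and) an isomorphism of real vector spaces. Moreover, for all $\widetilde\omega\in\Gamma_L(\wedge^k(T^t\mathcal{G})^*)$ with $\omega:=\varphi(\widetilde\omega)$, all $p\in M$, $g\in t^{-1}(p)$ and $X_1,\dots,X_{k+1}\in\Gamma(A\mathcal{G})$, $$[(d\widetilde\omega^{(p)})(\widetilde X_1,\dots,\widetilde X_{k+1})](g)=[(d_{A\mathcal{G}}\omega)(X_1,\dots,X_{k+1})](s(g)),$$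 where $d$ is the exterior derivative on the manifold $t^{-1}(p)$. -/

import Mathlib

open scoped Manifold ContDiff
open Manifold Set

set_option linter.unusedSectionVars false

noncomputable section

/-- A Lie groupoid `G ⇉ M`: `G` is a smooth manifold modelled on `E` and `M` is a smooth manifold
modelled on `E'`. The product `mul g h` is meaningful only for composable pairs, `src g = tgt h`;
its values on other pairs are irrelevant, and every axiom on `mul` is restricted to the
set of composable pairs. Smoothness on that embedded submanifold of `G × G` is smoothness within
the set. The source map is surjective because of `src_unit`, and smooth because it is a
submersion. -/
structure LieGroupoid (E E' G M : Type*)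
    [NormedAddCommGroup E] [NormedSpace ℝ E] [NormedAddCommGroup E'] [NormedSpace ℝ E']
    [TopologicalSpace G] [ChartedSpace E G] [IsManifold 𝓘(ℝ, E) ∞ G]
    [TopologicalSpace M] [ChartedSpace E' M] [IsManifold 𝓘(ℝ, E') ∞ M] where
  src : G → M
  tgt : G → M
  unit : M → G
  inv : G → G
  mul : G → G → G
  src_mul : ∀ g h, src g = tgt h → src (mul g h) = src h
  tgt_mul : ∀ g h, src g = tgt h → tgt (mul g h) = tgt g
  mul_assoc : ∀ g h l, src g = tgt h → src h = tgt l → mul (mul g h) l = mul g (mul h l)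
  src_unit : ∀ p, src (unit p) = p
  tgt_unit : ∀ p, tgt (unit p) = p
  unit_mul : ∀ g, mul (unit (tgt g)) g = g
  mul_unit : ∀ g, mul g (unit (src g)) = g
  src_inv : ∀ g, src (inv g) = tgt g
  tgt_inv : ∀ g, tgt (inv g) = src g
  inv_mul : ∀ g, mul (inv g) g = unit (src g)
  mul_inv : ∀ g, mul g (inv g) = unit (tgt g)
  contMDiff_tgt : ContMDiff 𝓘(ℝ, E) 𝓘(ℝ, E') ∞ tgt
  contMDiff_unit : ContMDiff 𝓘(ℝ, E') 𝓘(ℝ, E) ∞ unit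
  contMDiff_inv : ContMDiff 𝓘(ℝ, E) 𝓘(ℝ, E) ∞ inv
  contMDiffOn_mul : ContMDiffOn (𝓘(ℝ, E).prod 𝓘(ℝ, E)) 𝓘(ℝ, E) ∞
    (fun x : G × G ↦ mul x.1 x.2) {x | src x.1 = tgt x.2}
  isSubmersion_src : IsSubmersion 𝓘(ℝ, E) 𝓘(ℝ, E') ∞ src

section Fiber

variable {E E' G M : Type*}
  [NormedAddCommGroup E] [NormedSpace ℝ E] [NormedAddCommGroup E'] [NormedSpace ℝ E']
  [TopologicalSpace G] [ChartedSpace E G] [IsManifold 𝓘(ℝ, E) ∞ G]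
  [TopologicalSpace M] [ChartedSpace E' M] [IsManifold 𝓘(ℝ, E') ∞ M]
  {f : G → M} {p : M}

theorem submersion_chart_fst {F : Type*} [NormedAddCommGroup F] [NormedSpace ℝ F] {x : G}
    (h : IsSubmersionAtOfComplement F 𝓘(ℝ, E) 𝓘(ℝ, E') ∞ f x) {e : E}
    (he : e ∈ h.domChart.target) :
    h.codChart (f (h.domChart.symm e)) = (h.equiv e).1 := by
  have he' : e ∈ (h.domChart.extend 𝓘(ℝ, E)).target := by simpa using he
  simpa using h.writtenInCharts he'

variable {F : Type*} [NormedAddCommGroup F] [NormedSpace ℝ F]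

theorem submersion_chart_symm (x : {g : G // f g = p})
    (h : IsSubmersionAtOfComplement F 𝓘(ℝ, E) 𝓘(ℝ, E') ∞ f x.1) {w : F}
    (hw : h.equiv.symm (h.codChart p, w) ∈ h.domChart.target) :
    f (h.domChart.symm (h.equiv.symm (h.codChart p, w))) = p := by
  refine h.codChart.injOn (h.source_subset_preimage_source (h.domChart.map_target hw)) ?_ ?_
  · simpa [x.2] using h.mem_codChart_source
  · rw [submersion_chart_fst h hw]; simp

theorem submersion_chart_eq (x : {g : G // f g = p})
    (h : IsSubmersionAtOfComplement F 𝓘(ℝ, E) 𝓘(ℝ, E') ∞ f x.1) {y : G} (hy : f y = p)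
    (hys : y ∈ h.domChart.source) :
    h.equiv.symm (h.codChart p, (h.equiv (h.domChart y)).2) = h.domChart y := by
  rw [h.equiv.symm_apply_eq]
  have := submersion_chart_fst h (h.domChart.map_source hys)
  rw [h.domChart.left_inv hys, hy] at this
  rw [this]

/-- The slice chart of the fibre `f⁻¹(p)` of a submersion around one of its points: in adapted
charts `f` is the projection `(u, w) ↦ u`, and the chart of the fibre is `w`. -/
def fiberChart (x : {g : G // f g = p})
    (h : IsSubmersionAtOfComplement F 𝓘(ℝ, E) 𝓘(ℝ, E') ∞ f x.1) :
    OpenPartialHomeomorph {g : G // f g = p} F where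
  toFun y := (h.equiv (h.domChart y.1)).2
  invFun w :=
    open Classical in
    if hw : f (h.domChart.symm (h.equiv.symm (h.codChart p, w))) = p then ⟨_, hw⟩ else x
  source := {y | y.1 ∈ h.domChart.source}
  target := {w | h.equiv.symm (h.codChart p, w) ∈ h.domChart.target}
  map_source' y hy := by
    change h.equiv.symm (h.codChart p, (h.equiv (h.domChart y.1)).2) ∈ h.domChart.target
    rw [submersion_chart_eq x h y.2 hy]
    exact h.domChart.map_source hy
  map_target' w hw := by
    rw [dif_pos (submersion_chart_symm x h hw)]
    exact h.domChart.map_target hw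
  left_inv' y hy := by
    have h1 : h.domChart.symm (h.equiv.symm (h.codChart p, (h.equiv (h.domChart y.1)).2)) = y.1 := by
      rw [submersion_chart_eq x h y.2 hy, h.domChart.left_inv hy]
    rw [dif_pos (by rw [h1, y.2])]
    exact Subtype.ext h1
  right_inv' w hw := by
    rw [dif_pos (submersion_chart_symm x h hw)]
    change (h.equiv (h.domChart (h.domChart.symm (h.equiv.symm (h.codChart p, w))))).2 = w
    rw [h.domChart.right_inv hw]
    simp
  open_source := h.domChart.open_source.preimage continuous_subtype_val
  open_target := h.domChart.open_target.preimage (by fun_prop)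
  continuousOn_toFun := by
    have h1 : ContinuousOn (fun y : {g : G // f g = p} ↦ h.domChart y.1)
        {y | y.1 ∈ h.domChart.source} :=
      h.domChart.continuousOn.comp continuous_subtype_val.continuousOn fun y hy ↦ hy
    exact continuous_snd.comp_continuousOn (h.equiv.continuous.comp_continuousOn h1)
  continuousOn_invFun := by
    refine Topology.IsEmbedding.subtypeVal.isInducing.continuousOn_iff.2 ?_
    have h1 : ContinuousOn (fun w : F ↦ h.domChart.symm (h.equiv.symm (h.codChart p, w)))
        {w | h.equiv.symm (h.codChart p, w) ∈ h.domChart.target} :=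
      h.domChart.continuousOn_symm.comp (by fun_prop) fun w hw ↦ hw
    refine h1.congr fun w hw ↦ ?_
    simp [dif_pos (submersion_chart_symm x h hw)]

theorem fiberChart_apply (x : {g : G // f g = p})
    (h : IsSubmersionAtOfComplement F 𝓘(ℝ, E) 𝓘(ℝ, E') ∞ f x.1) (y : {g : G // f g = p}) :
    fiberChart x h y = (h.equiv (h.domChart y.1)).2 := rfl

theorem fiberChart_symm_apply (x : {g : G // f g = p})
    (h : IsSubmersionAtOfComplement F 𝓘(ℝ, E) 𝓘(ℝ, E') ∞ f x.1) {w : F}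
    (hw : w ∈ (fiberChart x h).target) :
    ((fiberChart x h).symm w).1 = h.domChart.symm (h.equiv.symm (h.codChart p, w)) := by
  have : (fiberChart x h).symm w = ⟨_, submersion_chart_symm x h hw⟩ :=
    dif_pos (submersion_chart_symm x h hw)
  rw [this]

end Fiber

namespace LieGroupoid

variable {E E' G M : Type*}
  [NormedAddCommGroup E] [NormedSpace ℝ E] [NormedAddCommGroup E'] [NormedSpace ℝ E']
  [TopologicalSpace G] [ChartedSpace E G] [IsManifold 𝓘(ℝ, E) ∞ G]
  [TopologicalSpace M] [ChartedSpace E' M] [IsManifold 𝓘(ℝ, E') ∞ M]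
  (L : LieGroupoid E E' G M)

theorem inv_inv (g : G) : L.inv (L.inv g) = g := by
  have h1 := L.mul_assoc (L.inv (L.inv g)) (L.inv g) g (by rw [L.src_inv]) (by rw [L.src_inv])
  rw [L.inv_mul, L.inv_mul, L.src_inv, L.unit_mul] at h1
  have h2 := L.mul_unit (L.inv (L.inv g))
  rw [L.src_inv, L.tgt_inv] at h2
  exact h2.symm.trans h1.symm

/-- Inversion as a homeomorphism. -/
def invHomeomorph : G ≃ₜ G where
  toFun := L.inv
  invFun := L.inv
  left_inv := L.inv_inv
  right_inv := L.inv_inv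
  continuous_toFun := L.contMDiff_inv.continuous
  continuous_invFun := L.contMDiff_inv.continuous

/-- The target map of a Lie groupoid is a submersion, being the source map composed with the
inversion diffeomorphism. -/
theorem isSubmersion_tgt : IsSubmersion 𝓘(ℝ, E) 𝓘(ℝ, E') ∞ L.tgt := by
  refine IsSubmersionOfComplement.isSubmersion (F := L.isSubmersion_src.complement) fun x ↦ ?_
  have h := L.isSubmersion_src.isSubmersionOfComplement_complement (L.inv x)
  have hmem : L.invHomeomorph.toOpenPartialHomeomorph.trans h.domChart ∈
      IsManifold.maximalAtlas 𝓘(ℝ, E) ∞ G := by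
    refine OpenPartialHomeomorph.mem_maximalAtlas_of_contMDiffOn _ ?_ ?_
    · exact (contMDiffOn_of_mem_maximalAtlas h.domChart_mem_maximalAtlas).comp
        L.contMDiff_inv.contMDiffOn fun y hy ↦ by simpa using hy
    · exact L.contMDiff_inv.comp_contMDiffOn
        ((contMDiffOn_symm_of_mem_maximalAtlas h.domChart_mem_maximalAtlas).mono
          fun y hy ↦ by simpa using hy)
  refine IsSubmersionAtOfComplement.mk_of_charts h.equiv
    (L.invHomeomorph.toOpenPartialHomeomorph.trans h.domChart) h.codChart ?_ ?_ hmem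
    h.codChart_mem_maximalAtlas ?_ ?_
  · exact ⟨mem_univ _, h.mem_domChart_source⟩
  · simpa [L.src_inv] using h.mem_codChart_source
  · intro y hy
    have := h.source_subset_preimage_source (a := L.inv y) hy.2
    simpa [L.src_inv] using this
  · intro e he
    have he' : e ∈ h.domChart.target := by simpa using he
    have := submersion_chart_fst h he'
    simpa [invHomeomorph, L.tgt_inv] using this

/-- The target fibre `t⁻¹(p)`. -/
abbrev Fiber (p : M) : Type _ := {g : G // L.tgt g = p}

/-- The model vector space of the target fibres. -/
abbrev FiberModel : Type _ := L.isSubmersion_tgt.complement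

theorem submersionAt (g : G) :
    IsSubmersionAtOfComplement L.FiberModel 𝓘(ℝ, E) 𝓘(ℝ, E') ∞ L.tgt g :=
  L.isSubmersion_tgt.isSubmersionOfComplement_complement g

/-- The slice chart of `t⁻¹(p)` centred around `x`. -/
def chart {p : M} (x : L.Fiber p) : OpenPartialHomeomorph (L.Fiber p) L.FiberModel :=
  fiberChart (f := L.tgt) (p := p) x (L.submersionAt x.1)

/-- The manifold structure of the target fibres, as embedded submanifolds of `G`. -/
instance (p : M) : ChartedSpace L.FiberModel (L.Fiber p) where
  atlas := range L.chart
  chartAt := L.chart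
  mem_chart_source x := (L.submersionAt x.1).mem_domChart_source
  chart_mem_atlas x := mem_range_self x

theorem chartAt_fiber {p : M} (x : L.Fiber p) : chartAt L.FiberModel x = L.chart x := rfl

theorem contMDiff_slice {p : M} (x : L.Fiber p) : ContMDiffOn 𝓘(ℝ, L.FiberModel) 𝓘(ℝ, E) ∞
    (fun w ↦ (L.submersionAt x.1).domChart.symm
      ((L.submersionAt x.1).equiv.symm ((L.submersionAt x.1).codChart p, w)))
    (L.chart x).target := by
  refine (contMDiffOn_symm_of_mem_maximalAtlas
    (L.submersionAt x.1).domChart_mem_maximalAtlas).comp ?_ fun w hw ↦ hw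
  rw [contMDiffOn_iff_contDiffOn]
  exact ((L.submersionAt x.1).equiv.symm.contDiff.comp
    (contDiff_const.prodMk contDiff_id)).contDiffOn

theorem contMDiff_retraction {p : M} (x : L.Fiber p) :
    ContMDiffOn 𝓘(ℝ, E) 𝓘(ℝ, L.FiberModel) ∞
    (fun g ↦ ((L.submersionAt x.1).equiv ((L.submersionAt x.1).domChart g)).2)
    (L.submersionAt x.1).domChart.source := by
  have h1 : ContMDiff 𝓘(ℝ, E) 𝓘(ℝ, L.FiberModel) ∞
      (fun e ↦ ((L.submersionAt x.1).equiv e).2) := by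
    rw [contMDiff_iff_contDiff]
    exact contDiff_snd.comp (L.submersionAt x.1).equiv.contDiff
  exact h1.comp_contMDiffOn (contMDiffOn_of_mem_maximalAtlas
    (L.submersionAt x.1).domChart_mem_maximalAtlas)

instance (p : M) : IsManifold 𝓘(ℝ, L.FiberModel) ∞ (L.Fiber p) := by
  refine isManifold_of_contDiffOn _ _ _ ?_
  rintro _ _ ⟨x, rfl⟩ ⟨y, rfl⟩
  rw [← contMDiffOn_iff_contDiffOn]
  have h := (L.contMDiff_retraction y).comp
    ((L.contMDiff_slice x).mono
      (t := (L.chart x).target ∩ (L.chart x).symm ⁻¹' (L.chart y).source) inter_subset_left)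
    (fun w hw ↦ by
      have h3 : ((L.chart x).symm w).1 ∈ (L.submersionAt y.1).domChart.source := hw.2
      have h4 := fiberChart_symm_apply x (L.submersionAt x.1) hw.1
      exact (congrArg (· ∈ (L.submersionAt y.1).domChart.source) h4).mp h3)
  refine (h.mono (fun w hw ↦ hw.1)).congr fun w hw ↦ ?_
  have h4 := fiberChart_symm_apply x (L.submersionAt x.1) hw.1.1
  exact congrArg (fun g ↦ ((L.submersionAt y.1).equiv ((L.submersionAt y.1).domChart g)).2) h4

theorem contMDiff_incl (p : M) :
    ContMDiff 𝓘(ℝ, L.FiberModel) 𝓘(ℝ, E) ∞ (fun x : L.Fiber p ↦ x.1) := by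
  intro x
  have h1 := (L.contMDiff_slice x).comp (contMDiffOn_chart (I := 𝓘(ℝ, L.FiberModel)) (n := ∞) (x := x))
    (fun y hy ↦ (L.chart x).map_source hy)
  refine (h1.congr fun y hy ↦ ?_).contMDiffAt
    ((chartAt L.FiberModel x).open_source.mem_nhds (mem_chart_source _ x))
  have h2 := fiberChart_symm_apply x (L.submersionAt x.1) ((L.chart x).map_source hy)
  have h3 := (L.chart x).left_inv hy
  change y.1 = _
  conv_lhs => rw [← h3]
  exact h2

/-- The fibre at `g` of `T^t G = ker t_*`. -/
def vert (g : G) : Submodule ℝ (TangentSpace 𝓘(ℝ, E) g) :=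
  LinearMap.ker (mfderiv 𝓘(ℝ, E) 𝓘(ℝ, E') L.tgt g).toLinearMap

theorem mfderiv_incl_mem {p : M} (x : L.Fiber p) (v : TangentSpace 𝓘(ℝ, L.FiberModel) x) :
    mfderiv 𝓘(ℝ, L.FiberModel) 𝓘(ℝ, E) (fun y : L.Fiber p ↦ y.1) x v ∈ L.vert x.1 := by
  have h1 : MDifferentiableAt 𝓘(ℝ, L.FiberModel) 𝓘(ℝ, E) (fun y : L.Fiber p ↦ y.1) x :=
    (L.contMDiff_incl p x).mdifferentiableAt (by simp)
  have h2 : MDifferentiableAt 𝓘(ℝ, E) 𝓘(ℝ, E') L.tgt x.1 :=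
    (L.contMDiff_tgt x.1).mdifferentiableAt (by simp)
  have h3 := mfderiv_comp x h2 h1
  have h4 : L.tgt ∘ (fun y : L.Fiber p ↦ y.1) = fun _ ↦ p := funext fun y ↦ y.2
  rw [h4, mfderiv_const] at h3
  exact (congrArg (fun A ↦ A v) h3).symm

/-- The differential of the inclusion `t⁻¹(p) → G` at `x`, as a map `T_x t⁻¹(p) → (T^t G)_x`. -/
def inclDeriv {p : M} (x : L.Fiber p) :
    TangentSpace 𝓘(ℝ, L.FiberModel) x →L[ℝ] L.vert x.1 :=
  (mfderiv 𝓘(ℝ, L.FiberModel) 𝓘(ℝ, E) (fun y : L.Fiber p ↦ y.1) x).codRestrict (L.vert x.1)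
    (L.mfderiv_incl_mem x)

theorem inclDeriv_bijective {p : M} (x : L.Fiber p) : Function.Bijective (L.inclDeriv x) := by
  have hι : MDifferentiableAt 𝓘(ℝ, L.FiberModel) 𝓘(ℝ, E) (fun y : L.Fiber p ↦ y.1) x :=
    (L.contMDiff_incl p x).mdifferentiableAt (by simp)
  have hdom : MDifferentiableAt 𝓘(ℝ, E) 𝓘(ℝ, E) (L.submersionAt x.1).domChart x.1 :=
    (contMDiffAt_of_mem_maximalAtlas (L.submersionAt x.1).domChart_mem_maximalAtlas
      (L.submersionAt x.1).mem_domChart_source).mdifferentiableAt (by simp)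
  have hcod : MDifferentiableAt 𝓘(ℝ, E') 𝓘(ℝ, E') (L.submersionAt x.1).codChart (L.tgt x.1) :=
    (contMDiffAt_of_mem_maximalAtlas (L.submersionAt x.1).codChart_mem_maximalAtlas
      (L.submersionAt x.1).mem_codChart_source).mdifferentiableAt (by simp)
  have htgt : MDifferentiableAt 𝓘(ℝ, E) 𝓘(ℝ, E') L.tgt x.1 :=
    (L.contMDiff_tgt x.1).mdifferentiableAt (by simp)
  have hdominj : Function.Injective
      (mfderiv 𝓘(ℝ, E) 𝓘(ℝ, E) (L.submersionAt x.1).domChart x.1) := by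
    have hd : (L.submersionAt x.1).domChart.MDifferentiable 𝓘(ℝ, E) 𝓘(ℝ, E) :=
      ⟨(contMDiffOn_of_mem_maximalAtlas
          (L.submersionAt x.1).domChart_mem_maximalAtlas).mdifferentiableOn (by simp),
        (contMDiffOn_symm_of_mem_maximalAtlas
          (L.submersionAt x.1).domChart_mem_maximalAtlas).mdifferentiableOn (by simp)⟩
    exact (hd.mfderiv_bijective (L.submersionAt x.1).mem_domChart_source).1
  let π₁ : E →L[ℝ] E' := (ContinuousLinearMap.fst ℝ E' L.FiberModel).comp
    ((L.submersionAt x.1).equiv : E →L[ℝ] E' × L.FiberModel)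
  let π₂ : E →L[ℝ] L.FiberModel := (ContinuousLinearMap.snd ℝ E' L.FiberModel).comp
    ((L.submersionAt x.1).equiv : E →L[ℝ] E' × L.FiberModel)
  have h1 : HasMFDerivAt 𝓘(ℝ, E) 𝓘(ℝ, E') (fun g ↦ π₁ ((L.submersionAt x.1).domChart g)) x.1
      (π₁.comp (mfderiv 𝓘(ℝ, E) 𝓘(ℝ, E) (L.submersionAt x.1).domChart x.1)) :=
    HasMFDerivAt.comp x.1 π₁.hasMFDerivAt hdom.hasMFDerivAt
  have h1' := HasMFDerivAt.comp x.1 hcod.hasMFDerivAt htgt.hasMFDerivAt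
  have h1e : (fun g ↦ π₁ ((L.submersionAt x.1).domChart g)) =ᶠ[nhds x.1]
      (L.submersionAt x.1).codChart ∘ L.tgt := by
    filter_upwards [(L.submersionAt x.1).domChart.open_source.mem_nhds
      (L.submersionAt x.1).mem_domChart_source] with g hg
    have := submersion_chart_fst (L.submersionAt x.1)
      ((L.submersionAt x.1).domChart.map_source hg)
    rw [(L.submersionAt x.1).domChart.left_inv hg] at this
    exact this.symm
  have h1c := hasMFDerivAt_unique h1 (h1'.congr_of_eventuallyEq h1e)
  have h2 : HasMFDerivAt 𝓘(ℝ, L.FiberModel) 𝓘(ℝ, L.FiberModel) (L.chart x) x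
      ((π₂.comp (mfderiv 𝓘(ℝ, E) 𝓘(ℝ, E) (L.submersionAt x.1).domChart x.1)).comp
        (mfderiv 𝓘(ℝ, L.FiberModel) 𝓘(ℝ, E) (fun y : L.Fiber p ↦ y.1) x)) :=
    HasMFDerivAt.comp (f := fun y : L.Fiber p ↦ y.1)
      (g := fun g ↦ π₂ ((L.submersionAt x.1).domChart g)) x
      (HasMFDerivAt.comp x.1 π₂.hasMFDerivAt hdom.hasMFDerivAt) hι.hasMFDerivAt
  have hb := (mdifferentiable_chart (I := 𝓘(ℝ, L.FiberModel)) x).mfderiv_bijective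
    (mem_chart_source _ x)
  have hmf : mfderiv 𝓘(ℝ, L.FiberModel) 𝓘(ℝ, L.FiberModel) (chartAt L.FiberModel x) x = _ :=
    h2.mfderiv
  rw [hmf] at hb
  constructor
  · intro v w hvw
    exact hb.1 (congrArg (fun u ↦ π₂ (mfderiv 𝓘(ℝ, E) 𝓘(ℝ, E) (L.submersionAt x.1).domChart x.1 u))
      (congrArg Subtype.val hvw))
  · intro v
    obtain ⟨w, hw⟩ := hb.2 (π₂ (mfderiv 𝓘(ℝ, E) 𝓘(ℝ, E) (L.submersionAt x.1).domChart x.1 v.1))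
    refine ⟨w, Subtype.ext (hdominj ((L.submersionAt x.1).equiv.injective (Prod.ext ?_ hw)))⟩
    have hker (u : L.vert x.1) :
        π₁ (mfderiv 𝓘(ℝ, E) 𝓘(ℝ, E) (L.submersionAt x.1).domChart x.1 u.1) = 0 := by
      refine (congrArg (fun A ↦ A u.1) h1c).trans ?_
      change mfderiv 𝓘(ℝ, E') 𝓘(ℝ, E') (L.submersionAt x.1).codChart (L.tgt x.1)
        (mfderiv 𝓘(ℝ, E) 𝓘(ℝ, E') L.tgt x.1 u.1) = 0
      have hu : mfderiv 𝓘(ℝ, E) 𝓘(ℝ, E') L.tgt x.1 u.1 = 0 := u.2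
      rw [hu, map_zero]
    exact (hker (L.inclDeriv x w)).trans (hker v).symm

/-- The identification `T_x t⁻¹(p) = (T^t G)_x`. -/
def fiberTangentEquiv {p : M} (x : L.Fiber p) :
    TangentSpace 𝓘(ℝ, L.FiberModel) x ≃ₗ[ℝ] L.vert x.1 :=
  LinearEquiv.ofBijective (L.inclDeriv x).toLinearMap (L.inclDeriv_bijective x)

end LieGroupoid

section Forms

variable {K N K' N' : Type*}
  [NormedAddCommGroup K] [NormedSpace ℝ K] [TopologicalSpace N] [ChartedSpace K N]
  [NormedAddCommGroup K'] [NormedSpace ℝ K'] [TopologicalSpace N'] [ChartedSpace K' N']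

/-- The pullback `f^*θ` of a differential form along a map of manifolds. -/
def formPullback {k : ℕ} (f : N → N')
    (θ : ∀ y : N', TangentSpace 𝓘(ℝ, K') y [⋀^Fin k]→L[ℝ] ℝ) (x : N) :
    TangentSpace 𝓘(ℝ, K) x [⋀^Fin k]→L[ℝ] ℝ :=
  (θ (f x)).compContinuousLinearMap (mfderiv 𝓘(ℝ, K) 𝓘(ℝ, K') f x)

/-- The exterior derivative of a differential form on a manifold: it is computed at `x` in the
chart at `x`. -/
def manifoldExtDeriv {k : ℕ} (θ : ∀ y : N, TangentSpace 𝓘(ℝ, K) y [⋀^Fin k]→L[ℝ] ℝ) (x : N) :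
    TangentSpace 𝓘(ℝ, K) x [⋀^Fin (k + 1)]→L[ℝ] ℝ :=
  formPullback (K := K) (K' := K) (extChartAt 𝓘(ℝ, K) x)
    (fun y : K ↦ extDeriv (E := K) (F := ℝ)
      (fun z : K ↦ formPullback (K := K) (K' := K) (extChartAt 𝓘(ℝ, K) x).symm θ z) y) x

end Forms

namespace LieGroupoid

variable {E E' G M : Type*}
  [NormedAddCommGroup E] [NormedSpace ℝ E] [NormedAddCommGroup E'] [NormedSpace ℝ E']
  [TopologicalSpace G] [ChartedSpace E G] [IsManifold 𝓘(ℝ, E) ∞ G]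
  [TopologicalSpace M] [ChartedSpace E' M] [IsManifold 𝓘(ℝ, E') ∞ M]
  (L : LieGroupoid E E' G M)

/-- Left multiplication `l_g : t⁻¹(s(g)) → t⁻¹(t(g))`. -/
def leftMul (g : G) (h : L.Fiber (L.src g)) : L.Fiber (L.tgt g) :=
  ⟨L.mul g h.1, L.tgt_mul g h.1 h.2.symm⟩

/-- The restriction of a section `θ` of `⋀^k (T^t G)^*` to `t⁻¹(p)`, a differential form on
`t⁻¹(p)`. -/
def fiberForm {k : ℕ} (θ : ∀ g : G, L.vert g [⋀^Fin k]→L[ℝ] ℝ) (p : M) (x : L.Fiber p) :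
    TangentSpace 𝓘(ℝ, L.FiberModel) x [⋀^Fin k]→L[ℝ] ℝ :=
  (θ x.1).compContinuousLinearMap (L.inclDeriv x)

/-- Smoothness on `U` of a section `X` of the pulled back bundle `f^*(T^t G)`, as a map to `TG`.
For `f = id` these are the sections of `T^t G`, and for `f` the unit map `M → G` those of `AG`. -/
def SmoothSectionOn {D N : Type*} [NormedAddCommGroup D] [NormedSpace ℝ D]
    [TopologicalSpace N] [ChartedSpace D N] (f : N → G) (X : ∀ n : N, L.vert (f n)) (U : Set N) :
    Prop :=
  ContMDiffOn 𝓘(ℝ, D) 𝓘(ℝ, E).tangent ∞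
    (fun n ↦ (⟨f n, (X n : TangentSpace 𝓘(ℝ, E) (f n))⟩ : TangentBundle 𝓘(ℝ, E) G)) U

/-- Smoothness of a section `θ` of `⋀^k (f^* T^t G)^*`: for all smooth local sections `X_i` of
`f^* T^t G` over an open set, the function `θ(X_1, …, X_k)` is smooth there.
For `f = id` these are the sections of `⋀^k (T^t G)^*`, and for `f` the unit map `M → G` those of
`⋀^k (AG)^*`. -/
def SmoothForm {D N : Type*} [NormedAddCommGroup D] [NormedSpace ℝ D]
    [TopologicalSpace N] [ChartedSpace D N] (f : N → G) {k : ℕ}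
    (θ : ∀ n : N, L.vert (f n) [⋀^Fin k]→L[ℝ] ℝ) : Prop :=
  ∀ U : Set N, IsOpen U → ∀ X : Fin k → ∀ n : N, L.vert (f n),
    (∀ i, L.SmoothSectionOn (D := D) f (X i) U) →
      ContMDiffOn 𝓘(ℝ, D) 𝓘(ℝ, ℝ) ∞ (fun n ↦ θ n (fun i ↦ X i n)) U

/-- The space of left-invariant smooth sections `θ` of `⋀^k (T^t G)^*`: those such that
`(l_g)^* (θ|_{t⁻¹(t(g))}) = θ|_{t⁻¹(s(g))}` for all `g`. -/
def leftInvariantForms (k : ℕ) : Submodule ℝ (∀ g : G, L.vert g [⋀^Fin k]→L[ℝ] ℝ) where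
  carrier := {θ | L.SmoothForm (D := E) (fun g : G ↦ g) θ ∧
    ∀ g : G, formPullback (L.leftMul g) (L.fiberForm θ (L.tgt g)) = L.fiberForm θ (L.src g)}
  add_mem' := by
    rintro a b ⟨ha, ha'⟩ ⟨hb, hb'⟩
    refine ⟨fun U hU X hX ↦ (ha U hU X hX).add (hb U hU X hX), fun g ↦ ?_⟩
    funext x
    have h1 := congrFun (ha' g) x
    have h2 := congrFun (hb' g) x
    ext v
    exact congrArg₂ (· + ·) (congrArg (fun A ↦ A v) h1) (congrArg (fun A ↦ A v) h2)
  zero_mem' := by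
    refine ⟨fun U hU X hX ↦ contMDiffOn_const, fun g ↦ ?_⟩
    funext x
    ext v
    rfl
  smul_mem' := by
    rintro c a ⟨ha, ha'⟩
    refine ⟨fun U hU X hX ↦ (contMDiffOn_const (I' := 𝓘(ℝ, ℝ)) (c := c)).smul (ha U hU X hX), fun g ↦ ?_⟩
    funext x
    have h1 := congrFun (ha' g) x
    ext v
    exact congrArg (c * ·) (congrArg (fun A ↦ A v) h1)

/-- The fibre at `p` of the Lie algebroid `AG = T^t G|_M`. -/
abbrev algebroidFiber (p : M) : Submodule ℝ (TangentSpace 𝓘(ℝ, E) (L.unit p)) :=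
  L.vert (L.unit p)

/-- The space of smooth sections of `⋀^k (AG)^*`. -/
def algebroidForms (k : ℕ) : Submodule ℝ (∀ p : M, L.algebroidFiber p [⋀^Fin k]→L[ℝ] ℝ) where
  carrier := {θ | L.SmoothForm (D := E') L.unit θ}
  add_mem' ha hb := fun U hU X hX ↦ (ha U hU X hX).add (hb U hU X hX)
  zero_mem' := fun U hU X hX ↦ contMDiffOn_const
  smul_mem' c a ha := fun U hU X hX ↦ (contMDiffOn_const (I' := 𝓘(ℝ, ℝ)) (c := c)).smul (ha U hU X hX)

/-- `X` is a smooth section of `AG`. -/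
def IsAlgebroidSection (X : ∀ p : M, L.algebroidFiber p) : Prop :=
  L.SmoothSectionOn (D := E') L.unit X univ

/-- The differential `(l_g)_{*,h}` of left multiplication, as a map `(T^t G)_h → (T^t G)_{gh}`. -/
def leftTranslate (g : G) (h : L.Fiber (L.src g)) : L.vert h.1 →ₗ[ℝ] L.vert (L.mul g h.1) :=
  (L.inclDeriv (L.leftMul g h)).toLinearMap ∘ₗ
    (mfderiv 𝓘(ℝ, L.FiberModel) 𝓘(ℝ, L.FiberModel) (L.leftMul g) h).toLinearMap ∘ₗ
      (L.fiberTangentEquiv h).symm.toLinearMap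

/-- The left-invariant vector field associated to a section `X` of `AG`: its value at `g` is
`(l_g)_{*,s(g)} X_{s(g)}`, transported along `g 1_{s(g)} = g`. -/
def leftExtend (X : ∀ p : M, L.algebroidFiber p) (g : G) : L.vert g :=
  L.mul_unit g ▸ L.leftTranslate g ⟨L.unit (L.src g), L.tgt_unit (L.src g)⟩ (X (L.src g))

open Classical in
/-- The bracket of sections of `AG`: the restriction to the units of the Lie bracket on `G` of the
associated left-invariant vector fields. For smooth sections that bracket is tangent to the target
fibres, so the default value never occurs; the theorem includes this fact. -/
def bracket (X Y : ∀ p : M, L.algebroidFiber p) (p : M) : L.algebroidFiber p :=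
  if h : VectorField.mlieBracket 𝓘(ℝ, E) (fun g ↦ (L.leftExtend X g : TangentSpace 𝓘(ℝ, E) g))
      (fun g ↦ (L.leftExtend Y g : TangentSpace 𝓘(ℝ, E) g)) (L.unit p) ∈ L.vert (L.unit p)
  then ⟨_, h⟩ else 0

/-- The anchor `ρ = s_*|_{AG}`, with `T_{s(1_p)} M` identified with `T_p M` along `s(1_p) = p`. -/
def anchor (p : M) (v : L.algebroidFiber p) : TangentSpace 𝓘(ℝ, E') p :=
  L.src_unit p ▸ mfderiv 𝓘(ℝ, E) 𝓘(ℝ, E') L.src (L.unit p) v.1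

/-- The derivative `ρ(X)f` of a function `f` on `M` along the anchor of a section `X` of `AG`. -/
def anchorDeriv (X : ∀ p : M, L.algebroidFiber p) (f : M → ℝ) (p : M) : ℝ :=
  mfderiv 𝓘(ℝ, E') 𝓘(ℝ, ℝ) f p (L.anchor p (X p))

/-- The part of the exterior derivative that contains brackets: the sum over `i < j` of
`(-1)^(i+j) θ([X_i, X_j], X_0, …, X̂_i, …, X̂_j, …, X_k)`. For `k = 0` there are no such pairs; for
`k = n + 1` the pairs are `(i, j + 1)` with `0 ≤ i ≤ j ≤ n`. -/
def bracketSum : {k : ℕ} → (∀ p : M, L.algebroidFiber p [⋀^Fin k]→L[ℝ] ℝ) →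
    (Fin (k + 1) → ∀ p : M, L.algebroidFiber p) → M → ℝ
  | 0, _, _, _ => 0
  | n + 1, θ, X, p =>
      ∑ i : Fin (n + 1), ∑ j ∈ Finset.Ici i, (-1 : ℝ) ^ ((i : ℕ) + ((j : ℕ) + 1)) *
        θ p (Matrix.vecCons (L.bracket (X i.castSucc) (X j.succ) p)
          (j.removeNth (i.castSucc.removeNth fun l ↦ X l p)))

/-- The Lie algebroid exterior derivative of a section `θ` of `⋀^k (AG)^*`, evaluated on sections
`X_0, …, X_k` of `AG`. -/
def algebroidDeriv {k : ℕ} (θ : ∀ p : M, L.algebroidFiber p [⋀^Fin k]→L[ℝ] ℝ)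
    (X : Fin (k + 1) → ∀ p : M, L.algebroidFiber p) (p : M) : ℝ :=
  (∑ i : Fin (k + 1), (-1 : ℝ) ^ (i : ℕ) *
    L.anchorDeriv (X i) (fun q ↦ θ q (i.removeNth fun l ↦ X l q)) p) + L.bracketSum θ X p

end LieGroupoid
end

noncomputable section

open scoped Topology

/-! ### Slice coordinates adapted to the target submersion. -/

namespace LieGroupoid

variable {E E' G M : Type*}
  [NormedAddCommGroup E] [NormedSpace ℝ E] [NormedAddCommGroup E'] [NormedSpace ℝ E']
  [TopologicalSpace G] [ChartedSpace E G] [IsManifold 𝓘(ℝ, E) ∞ G]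
  [TopologicalSpace M] [ChartedSpace E' M] [IsManifold 𝓘(ℝ, E') ∞ M]
  (L : LieGroupoid E E' G M)

/-! A submersion chart of t at c gives one coordinate w on all nearby target fibres at once. A
composable pair (a, b) with b near c is therefore described by a and the coordinate of b, and
multiplication becomes `mulSlice`, a map on an open subset of a product. Ordinary smoothness there
replaces smoothness within the set of composable pairs. Its derivative in w yields left translation
of vertical vectors as a linear map `translate` of the model space. Differentiating a(by) = (ab)y,
ey = y and s(ay) = s(y) gives `translate_translate`, `translate_unit` and `srcDeriv_translate`.

A left-invariant form is determined at the units: its value at g is the value at the unit of s(g),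
pulled back by left translation by g⁻¹ (`extendForm_restrict`). The same formula extends any η, and
the result is invariant because (gx)⁻¹g = x⁻¹ (`isLeftInvariant_extendForm`). Restriction preserves
smoothness because test sections extend left-invariantly (`smoothForm_restrict`); extension does
because translated vectors expand in a local frame with smooth coefficients
(`smoothForm_extendForm`).

For the differential, the vector-field formula for d is applied in a chart of the target fibre. By
invariance the evaluation of the form on left-invariant fields is ω(X₁, …) ∘ s, and X̃ is s-related
to ρ(X) (`srcDeriv_leftExtend`), which gives the anchor terms (`fderiv_chartForm`). The coordinate
field of X̃ on t⁻¹(q) is carried to X̃ by multiplication with every a such that s(a) = q. Naturality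
of the Lie bracket (`mulSliceDeriv_lieBracket`) thus makes [X̃, Ỹ] vertical and left-invariant,
hence the extension of [X, Y] (`leftExtend_bracket`), which gives the bracket terms. -/

/-- The domain of the submersion chart of `t` centred at `c`. -/
def chartDomain (c : G) : Set G := (L.submersionAt c).domChart.source

/-- The vertical coordinate of `g` in the submersion chart of `t` centred at `c`. -/
def coord (c g : G) : L.FiberModel :=
  ((L.submersionAt c).equiv ((L.submersionAt c).domChart g)).2

/-- The point of `t⁻¹(q)` with vertical coordinate `w` in the submersion chart centred at `c`. -/
def slice (c : G) (q : M) (w : L.FiberModel) : G :=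
  (L.submersionAt c).domChart.symm
    ((L.submersionAt c).equiv.symm ((L.submersionAt c).codChart q, w))

/-- The pairs `(q, w)` for which `L.slice c q w` is meaningful. -/
def sliceDomain (c : G) : Set (M × L.FiberModel) :=
  {x | x.1 ∈ (L.submersionAt c).codChart.source ∧
    (L.submersionAt c).equiv.symm ((L.submersionAt c).codChart x.1, x.2) ∈
      (L.submersionAt c).domChart.target}

theorem isOpen_chartDomain (c : G) : IsOpen (L.chartDomain c) :=
  (L.submersionAt c).domChart.open_source

theorem mem_chartDomain (c : G) : c ∈ L.chartDomain c :=
  (L.submersionAt c).mem_domChart_source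

theorem isOpen_sliceDomain (c : G) : IsOpen (L.sliceDomain c) := by
  have h1 : ContinuousOn (fun x : M × L.FiberModel ↦ (L.submersionAt c).equiv.symm
      ((L.submersionAt c).codChart x.1, x.2)) ((L.submersionAt c).codChart.source ×ˢ univ) := by
    refine (L.submersionAt c).equiv.symm.continuous.comp_continuousOn (ContinuousOn.prodMk ?_ ?_)
    · exact (L.submersionAt c).codChart.continuousOn.comp continuous_fst.continuousOn
        fun x hx ↦ hx.1
    · exact continuous_snd.continuousOn
  have h2 := h1.isOpen_inter_preimage ((L.submersionAt c).codChart.open_source.prod isOpen_univ)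
    (L.submersionAt c).domChart.open_target
  convert h2 using 1
  ext x
  simp [sliceDomain]

theorem tgt_slice {c : G} {q : M} {w : L.FiberModel} (h : (q, w) ∈ L.sliceDomain c) :
    L.tgt (L.slice c q w) = q := by
  refine (L.submersionAt c).codChart.injOn ((L.submersionAt c).source_subset_preimage_source
    ((L.submersionAt c).domChart.map_target h.2)) h.1 ?_
  exact (submersion_chart_fst (L.submersionAt c) h.2).trans (by simp)

theorem slice_mem {c : G} {q : M} {w : L.FiberModel} (h : (q, w) ∈ L.sliceDomain c) :
    L.slice c q w ∈ L.chartDomain c :=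
  (L.submersionAt c).domChart.map_target h.2

theorem coord_slice {c : G} {q : M} {w : L.FiberModel} (h : (q, w) ∈ L.sliceDomain c) :
    L.coord c (L.slice c q w) = w := by
  unfold coord slice
  rw [(L.submersionAt c).domChart.right_inv h.2]
  simp

theorem equiv_symm_coord {c g : G} (h : g ∈ L.chartDomain c) :
    (L.submersionAt c).equiv.symm ((L.submersionAt c).codChart (L.tgt g), L.coord c g) =
      (L.submersionAt c).domChart g := by
  rw [(L.submersionAt c).equiv.symm_apply_eq]
  have := submersion_chart_fst (L.submersionAt c) ((L.submersionAt c).domChart.map_source h)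
  rw [(L.submersionAt c).domChart.left_inv h] at this
  rw [this]
  rfl

theorem mem_sliceDomain {c g : G} (h : g ∈ L.chartDomain c) :
    (L.tgt g, L.coord c g) ∈ L.sliceDomain c := by
  refine ⟨(L.submersionAt c).source_subset_preimage_source h, ?_⟩
  change (L.submersionAt c).equiv.symm _ ∈ _
  rw [L.equiv_symm_coord h]
  exact (L.submersionAt c).domChart.map_source h

theorem slice_coord {c g : G} (h : g ∈ L.chartDomain c) :
    L.slice c (L.tgt g) (L.coord c g) = g := by
  unfold slice
  rw [L.equiv_symm_coord h, (L.submersionAt c).domChart.left_inv h]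

theorem contMDiffOn_coord (c : G) :
    ContMDiffOn 𝓘(ℝ, E) 𝓘(ℝ, L.FiberModel) ∞ (L.coord c) (L.chartDomain c) :=
  L.contMDiff_retraction (p := L.tgt c) ⟨c, rfl⟩

theorem contMDiffAt_coord {c g : G} (h : g ∈ L.chartDomain c) :
    ContMDiffAt 𝓘(ℝ, E) 𝓘(ℝ, L.FiberModel) ∞ (L.coord c) g :=
  (L.contMDiffOn_coord c).contMDiffAt ((L.isOpen_chartDomain c).mem_nhds h)

theorem mdifferentiableAt_coord {c g : G} (h : g ∈ L.chartDomain c) :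
    MDifferentiableAt 𝓘(ℝ, E) 𝓘(ℝ, L.FiberModel) (L.coord c) g :=
  (L.contMDiffAt_coord h).mdifferentiableAt (by simp)

/-- Smoothness is joint in the base point and the coordinate: the base point will be s(a) with a
varying. -/
theorem contMDiffOn_slice (c : G) :
    ContMDiffOn (𝓘(ℝ, E').prod 𝓘(ℝ, L.FiberModel)) 𝓘(ℝ, E) ∞
      (fun x : M × L.FiberModel ↦ L.slice c x.1 x.2) (L.sliceDomain c) := by
  refine (contMDiffOn_symm_of_mem_maximalAtlas
    (L.submersionAt c).domChart_mem_maximalAtlas).comp ?_ fun w hw ↦ hw.2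
  have h1 : ContMDiffOn (𝓘(ℝ, E').prod 𝓘(ℝ, L.FiberModel)) 𝓘(ℝ, E') ∞
      (fun x : M × L.FiberModel ↦ (L.submersionAt c).codChart x.1) (L.sliceDomain c) :=
    (contMDiffOn_of_mem_maximalAtlas (L.submersionAt c).codChart_mem_maximalAtlas).comp
      contMDiffOn_fst fun x hx ↦ hx.1
  have h2 := h1.prodMk_space (contMDiffOn_snd (I := 𝓘(ℝ, E')) (J := 𝓘(ℝ, L.FiberModel)))
  exact ((L.submersionAt c).equiv.symm.contDiff.contMDiff).comp_contMDiffOn h2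

/-! ### Multiplication in slice coordinates and its derivative. -/

/-- The product of `a` with the points of `t⁻¹(s(a))`, the latter in the slice coordinate centred
at `c`. -/
def mulSlice (c a : G) (w : L.FiberModel) : G := L.mul a (L.slice c (L.src a) w)

theorem contMDiff_src : ContMDiff 𝓘(ℝ, E) 𝓘(ℝ, E') ∞ L.src := L.isSubmersion_src.contMDiff

/-- The slice over s(a) consists of points composable with a, so an open subset of a product maps
smoothly into the set where multiplication is smooth. -/
theorem contMDiffAt_mulSlice {c a : G} {w : L.FiberModel} (h : (L.src a, w) ∈ L.sliceDomain c) :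
    ContMDiffAt (𝓘(ℝ, E).prod 𝓘(ℝ, L.FiberModel)) 𝓘(ℝ, E) ∞
      (Function.uncurry (L.mulSlice c)) (a, w) := by
  have h0 : ContMDiff (𝓘(ℝ, E).prod 𝓘(ℝ, L.FiberModel)) (𝓘(ℝ, E').prod 𝓘(ℝ, L.FiberModel)) ∞
      (fun x : G × L.FiberModel ↦ (L.src x.1, x.2)) :=
    (L.contMDiff_src.comp contMDiff_fst).prodMk contMDiff_snd
  have h1 : ContMDiffOn (𝓘(ℝ, E).prod 𝓘(ℝ, L.FiberModel)) 𝓘(ℝ, E) ∞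
      (fun x : G × L.FiberModel ↦ L.slice c (L.src x.1) x.2)
      ((fun x : G × L.FiberModel ↦ (L.src x.1, x.2)) ⁻¹' L.sliceDomain c) :=
    (L.contMDiffOn_slice c).comp h0.contMDiffOn fun x hx ↦ hx
  have h2 := L.contMDiffOn_mul.comp (contMDiffOn_fst.prodMk h1)
    (fun x hx ↦ (L.tgt_slice hx).symm)
  exact h2.contMDiffAt (((L.isOpen_sliceDomain c).preimage h0.continuous).mem_nhds h)

theorem contMDiffAt_mulSlice_right {c a : G} {w : L.FiberModel}
    (h : (L.src a, w) ∈ L.sliceDomain c) :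
    ContMDiffAt 𝓘(ℝ, L.FiberModel) 𝓘(ℝ, E) ∞ (L.mulSlice c a) w :=
  ContMDiffAt.comp (I' := 𝓘(ℝ, E).prod 𝓘(ℝ, L.FiberModel)) w
    (g := Function.uncurry (L.mulSlice c)) (f := fun w ↦ (a, w))
    (L.contMDiffAt_mulSlice h) (contMDiffAt_const.prodMk contMDiffAt_id)

theorem mdifferentiableAt_mulSlice {c a : G} {w : L.FiberModel}
    (h : (L.src a, w) ∈ L.sliceDomain c) :
    MDifferentiableAt 𝓘(ℝ, L.FiberModel) 𝓘(ℝ, E) (L.mulSlice c a) w :=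
  (L.contMDiffAt_mulSlice_right h).mdifferentiableAt (by simp)

/-- The differential of `L.coord c` at `g`. -/
def coordDeriv (c g : G) : E →L[ℝ] L.FiberModel :=
  mfderiv 𝓘(ℝ, E) 𝓘(ℝ, L.FiberModel) (L.coord c) g

/-- The differential of `L.mulSlice c a` at `w`. -/
def mulSliceDeriv (c a : G) (w : L.FiberModel) : L.FiberModel →L[ℝ] E :=
  mfderiv 𝓘(ℝ, L.FiberModel) 𝓘(ℝ, E) (L.mulSlice c a) w

theorem hasMFDerivAt_coord {c g : G} (h : g ∈ L.chartDomain c) :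
    HasMFDerivAt 𝓘(ℝ, E) 𝓘(ℝ, L.FiberModel) (L.coord c) g (L.coordDeriv c g) :=
  (L.mdifferentiableAt_coord h).hasMFDerivAt

theorem hasMFDerivAt_mulSlice {c a : G} {w : L.FiberModel}
    (h : (L.src a, w) ∈ L.sliceDomain c) :
    HasMFDerivAt 𝓘(ℝ, L.FiberModel) 𝓘(ℝ, E) (L.mulSlice c a) w (L.mulSliceDeriv c a w) :=
  (L.mdifferentiableAt_mulSlice h).hasMFDerivAt

/-- Left translation by `a` of vertical vectors at `b`, computed in the slice centred at `c`. -/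
def translate (c a b : G) : E →L[ℝ] E :=
  (L.mulSliceDeriv c a (L.coord c b)).comp (L.coordDeriv c b)

section

variable {D N : Type*} [NormedAddCommGroup D] [NormedSpace ℝ D] [TopologicalSpace N]
  [ChartedSpace D N]

/-- Near x, all values of f lie in t⁻¹(s(a)), so multiplication by a factors through the slice
coordinate and the chain rule applies. Every rule for `translate` below is this lemma together with
uniqueness of derivatives. -/
theorem hasMFDerivAt_mul {f : N → G} {f' : D →L[ℝ] E} {x : N} {a c : G}
    (hf : HasMFDerivAt 𝓘(ℝ, D) 𝓘(ℝ, E) f x f') (ha : ∀ᶠ y in 𝓝 x, L.tgt (f y) = L.src a)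
    (hc : f x ∈ L.chartDomain c) :
    HasMFDerivAt 𝓘(ℝ, D) 𝓘(ℝ, E) (fun y ↦ L.mul a (f y)) x ((L.translate c a (f x)).comp f') := by
  have h1 : (L.src a, L.coord c (f x)) ∈ L.sliceDomain c := by
    rw [← ha.self_of_nhds]; exact L.mem_sliceDomain hc
  have h2 := HasMFDerivAt.comp (g := L.mulSlice c a ∘ L.coord c) x
    (HasMFDerivAt.comp (g := L.mulSlice c a) (f := L.coord c) (f x) (L.hasMFDerivAt_mulSlice h1)
      (L.hasMFDerivAt_coord hc)) hf
  refine h2.congr_of_eventuallyEq ?_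
  filter_upwards [ha, hf.continuousAt.preimage_mem_nhds ((L.isOpen_chartDomain c).mem_nhds hc)]
    with y hy1 hy2
  change L.mul a (f y) = L.mul a (L.slice c (L.src a) (L.coord c (f y)))
  rw [← hy1, L.slice_coord hy2]

end

theorem hasMFDerivAt_incl {p : M} (x : L.Fiber p) :
    HasMFDerivAt 𝓘(ℝ, L.FiberModel) 𝓘(ℝ, E) (fun y : L.Fiber p ↦ y.1) x
      (mfderiv 𝓘(ℝ, L.FiberModel) 𝓘(ℝ, E) (fun y : L.Fiber p ↦ y.1) x) :=
  ((L.contMDiff_incl p x).mdifferentiableAt (by simp)).hasMFDerivAt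

/-- The fibre carries the induced topology and its charts are restrictions of `coord`, which is
smooth on an open set of G. -/
theorem contMDiffAt_toFiber {D N : Type*} [NormedAddCommGroup D] [NormedSpace ℝ D]
    [TopologicalSpace N] [ChartedSpace D N] {p : M} {f : N → L.Fiber p} {x : N}
    (hf : ContMDiffAt 𝓘(ℝ, D) 𝓘(ℝ, E) ∞ (fun y ↦ (f y).1) x) :
    ContMDiffAt 𝓘(ℝ, D) 𝓘(ℝ, L.FiberModel) ∞ f x := by
  rw [contMDiffAt_iff_target]
  refine ⟨Topology.IsInducing.subtypeVal.continuousAt_iff.2 hf.continuousAt, ?_⟩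
  exact ContMDiffAt.comp x (g := L.coord (f x).1) (f := fun y ↦ (f y).1)
    (L.contMDiffAt_coord (L.mem_chartDomain (f x).1)) hf

theorem contMDiff_leftMul (g : G) :
    ContMDiff 𝓘(ℝ, L.FiberModel) 𝓘(ℝ, L.FiberModel) ∞ (L.leftMul g) := by
  intro x
  refine L.contMDiffAt_toFiber ?_
  have h1 : (L.src g, L.coord x.1 x.1) ∈ L.sliceDomain x.1 := by
    have := L.mem_sliceDomain (L.mem_chartDomain x.1)
    rwa [x.2] at this
  have h2 := ContMDiffAt.comp x (g := L.mulSlice x.1 g ∘ L.coord x.1)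
    (ContMDiffAt.comp x.1 (g := L.mulSlice x.1 g) (f := L.coord x.1) (L.contMDiffAt_mulSlice_right h1)
      (L.contMDiffAt_coord (L.mem_chartDomain x.1))) (L.contMDiff_incl (L.src g) x)
  refine h2.congr_of_eventuallyEq ?_
  filter_upwards [continuous_subtype_val.continuousAt.preimage_mem_nhds
    ((L.isOpen_chartDomain x.1).mem_nhds (L.mem_chartDomain x.1))] with y hy
  change L.mul g y.1 = L.mul g (L.slice x.1 (L.src g) (L.coord x.1 y.1))
  have := L.slice_coord hy
  rw [y.2] at this
  rw [this]

theorem leftTranslate_inclDeriv {g : G} (x : L.Fiber (L.src g))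
    (u : TangentSpace 𝓘(ℝ, L.FiberModel) x) :
    L.leftTranslate g x (L.inclDeriv x u) = L.inclDeriv (L.leftMul g x)
      (mfderiv 𝓘(ℝ, L.FiberModel) 𝓘(ℝ, L.FiberModel) (L.leftMul g) x u) := by
  have : (L.fiberTangentEquiv x).symm (L.inclDeriv x u) = u :=
    (L.fiberTangentEquiv x).symm_apply_apply u
  change L.inclDeriv _ (mfderiv _ _ _ _ ((L.fiberTangentEquiv x).symm (L.inclDeriv x u))) = _
  rw [this]

/-- `leftTranslate` may be computed in any slice. -/
theorem leftTranslate_val {g c : G} (x : L.Fiber (L.src g)) (hc : x.1 ∈ L.chartDomain c)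
    (v : L.vert x.1) : (L.leftTranslate g x v).1 = L.translate c g x.1 v.1 := by
  obtain ⟨u, rfl⟩ := (L.inclDeriv_bijective x).2 v
  rw [L.leftTranslate_inclDeriv]
  have h1 := L.hasMFDerivAt_mul (L.hasMFDerivAt_incl x) (a := g)
    (Filter.Eventually.of_forall fun y ↦ y.2) hc
  have h2 : HasMFDerivAt 𝓘(ℝ, L.FiberModel) 𝓘(ℝ, E) (fun y ↦ (L.leftMul g y).1) x _ :=
    HasMFDerivAt.comp x (L.hasMFDerivAt_incl (L.leftMul g x))
      ((L.contMDiff_leftMul g x).mdifferentiableAt (by simp)).hasMFDerivAt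
  exact congrArg (fun A ↦ A u) (hasMFDerivAt_unique h2 h1)

/-! ### Rules for left translation of vertical vectors. -/

/-- Membership in `L.vert g` of a vector of the model space. -/
def IsVert (g : G) (v : E) : Prop := v ∈ L.vert g

/-- Comparing the vectors in the model space E avoids transport along equalities of base points. -/
theorem form_congr {k : ℕ} (θ : ∀ g : G, L.vert g [⋀^Fin k]→L[ℝ] ℝ) {g g' : G} (h : g = g')
    {v : Fin k → L.vert g} {v' : Fin k → L.vert g'} (hv : ∀ i, ((v i).1 : E) = (v' i).1) :
    θ g v = θ g' v' := by
  subst h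
  exact congrArg _ (funext fun i ↦ Subtype.ext (hv i))

theorem exists_inclDeriv {g : G} {v : E} (hv : L.IsVert g v) :
    ∃ u : L.FiberModel, (mfderiv 𝓘(ℝ, L.FiberModel) 𝓘(ℝ, E)
      (fun y : L.Fiber (L.tgt g) ↦ y.1) ⟨g, rfl⟩ : L.FiberModel →L[ℝ] E) u = v := by
  obtain ⟨u, hu⟩ := (L.inclDeriv_bijective ⟨g, rfl⟩).2 ⟨v, hv⟩
  exact ⟨u, congrArg Subtype.val hu⟩

theorem isVert_translate {a b c : G} (h : L.src a = L.tgt b) (hc : b ∈ L.chartDomain c) {v : E}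
    (hv : L.IsVert b v) : L.IsVert (L.mul a b) (L.translate c a b v) := by
  have h1 := L.leftTranslate_val (g := a) ⟨b, h.symm⟩ hc ⟨v, hv⟩
  have h2 := (L.leftTranslate a ⟨b, h.symm⟩ ⟨v, hv⟩).2
  exact (congrArg (L.IsVert (L.mul a b)) h1).mp h2

/-- Verticality matters: off the vertical space, `translate` depends on the chosen slice. -/
theorem translate_eq {a b c c' : G} (h : L.src a = L.tgt b) (hc : b ∈ L.chartDomain c)
    (hc' : b ∈ L.chartDomain c') {v : E} (hv : L.IsVert b v) :
    L.translate c a b v = L.translate c' a b v :=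
  (L.leftTranslate_val (g := a) ⟨b, h.symm⟩ hc ⟨v, hv⟩).symm.trans
    (L.leftTranslate_val (g := a) ⟨b, h.symm⟩ hc' ⟨v, hv⟩)

/-- Both sides differentiate the same map y ↦ a(by) = (ab)y on the target fibre through d. -/
theorem translate_translate {a b d c₁ c₂ c₃ : G} (hab : L.src a = L.tgt b)
    (hbd : L.src b = L.tgt d) (h₁ : L.mul b d ∈ L.chartDomain c₁) (h₂ : d ∈ L.chartDomain c₂)
    (h₃ : d ∈ L.chartDomain c₃) {v : E} (hv : L.IsVert d v) :
    L.translate c₁ a (L.mul b d) (L.translate c₂ b d v) = L.translate c₃ (L.mul a b) d v := by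
  obtain ⟨u, rfl⟩ := L.exists_inclDeriv hv
  have k1 := L.hasMFDerivAt_mul (L.hasMFDerivAt_incl (⟨d, rfl⟩ : L.Fiber (L.tgt d))) (a := b)
    (Filter.Eventually.of_forall fun y ↦ y.2.trans hbd.symm) h₂
  have k2 := L.hasMFDerivAt_mul k1 (a := a) (Filter.Eventually.of_forall fun y ↦
    (L.tgt_mul b y.1 (hbd.trans y.2.symm)).trans hab.symm) h₁
  have k3 := L.hasMFDerivAt_mul (L.hasMFDerivAt_incl (⟨d, rfl⟩ : L.Fiber (L.tgt d)))
    (a := L.mul a b) (Filter.Eventually.of_forall fun y ↦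
      y.2.trans (hbd.symm.trans (L.src_mul a b hab).symm)) h₃
  have k4 : (fun y : L.Fiber (L.tgt d) ↦ L.mul a (L.mul b y.1)) =
      fun y ↦ L.mul (L.mul a b) y.1 :=
    funext fun y ↦ (L.mul_assoc a b y.1 hab (hbd.trans y.2.symm)).symm
  rw [k4] at k2
  exact congrArg (fun A ↦ A u) (hasMFDerivAt_unique k2 k3)

theorem translate_unit {b c : G} {p : M} (hp : L.tgt b = p) (hc : b ∈ L.chartDomain c) {v : E}
    (hv : L.IsVert b v) : L.translate c (L.unit p) b v = v := by
  obtain ⟨u, rfl⟩ := L.exists_inclDeriv hv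
  have k1 := L.hasMFDerivAt_mul (L.hasMFDerivAt_incl (⟨b, rfl⟩ : L.Fiber (L.tgt b)))
    (a := L.unit p) (Filter.Eventually.of_forall fun y ↦
      y.2.trans (hp.trans (L.src_unit p).symm)) hc
  have k4 : (fun y : L.Fiber (L.tgt b) ↦ L.mul (L.unit p) y.1) = fun y ↦ y.1 :=
    funext fun y ↦ (congrArg (fun q ↦ L.mul (L.unit q) y.1) (hp.symm.trans y.2.symm)).trans (L.unit_mul y.1)
  rw [k4] at k1
  exact congrArg (fun A ↦ A u)
    (hasMFDerivAt_unique k1 (L.hasMFDerivAt_incl (⟨b, rfl⟩ : L.Fiber (L.tgt b))))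

/-- The differential of the source map. -/
def srcDeriv (g : G) : E →L[ℝ] E' := mfderiv 𝓘(ℝ, E) 𝓘(ℝ, E') L.src g

theorem hasMFDerivAt_src (g : G) : HasMFDerivAt 𝓘(ℝ, E) 𝓘(ℝ, E') L.src g (L.srcDeriv g) :=
  ((L.contMDiff_src g).mdifferentiableAt (by simp)).hasMFDerivAt

/-- Differentiate s(ay) = s(y) along the target fibre through b. -/
theorem srcDeriv_translate {a b c : G} (h : L.src a = L.tgt b) (hc : b ∈ L.chartDomain c) {v : E}
    (hv : L.IsVert b v) : L.srcDeriv (L.mul a b) (L.translate c a b v) = L.srcDeriv b v := by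
  obtain ⟨u, rfl⟩ := L.exists_inclDeriv hv
  have k0 := L.hasMFDerivAt_incl (⟨b, rfl⟩ : L.Fiber (L.tgt b))
  have k1 := L.hasMFDerivAt_mul k0 (a := a)
    (Filter.Eventually.of_forall fun y ↦ y.2.trans h.symm) hc
  have k2 := HasMFDerivAt.comp _ (L.hasMFDerivAt_src _) k1
  have k3 := HasMFDerivAt.comp _ (L.hasMFDerivAt_src _) k0
  have k4 : L.src ∘ (fun y : L.Fiber (L.tgt b) ↦ L.mul a y.1) = L.src ∘ fun y ↦ y.1 :=
    funext fun y ↦ L.src_mul a y.1 (h.trans y.2.symm)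
  rw [k4] at k2
  exact congrArg (fun A ↦ A u) (hasMFDerivAt_unique k2 k3)

theorem leftExtend_val (X : ∀ p : M, L.algebroidFiber p) {g c : G} {q : M} (hq : L.src g = q)
    (hc : L.unit q ∈ L.chartDomain c) :
    ((L.leftExtend X g).1 : E) = L.translate c g (L.unit q) (X q).1 := by
  subst hq
  have key : ∀ (g' : G) (h : g' = g) (v : L.vert g'), ((h ▸ v : L.vert g).1 : E) = v.1 := by
    rintro _ rfl v; rfl
  exact (key _ (L.mul_unit g) _).trans (L.leftTranslate_val (g := g) _ hc _)

/-- Left invariance of X̃: translating from the unit to b and then by a is translating from the unit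
by ab. -/
theorem leftExtend_mul (X : ∀ p : M, L.algebroidFiber p) {a b c : G} (h : L.src a = L.tgt b)
    (hc : b ∈ L.chartDomain c) :
    ((L.leftExtend X (L.mul a b)).1 : E) = L.translate c a b (L.leftExtend X b).1 := by
  rw [L.leftExtend_val X (L.src_mul a b h) (L.mem_chartDomain _),
    L.leftExtend_val X rfl (L.mem_chartDomain _)]
  have h1 := L.translate_translate h (L.tgt_unit (L.src b)).symm (c₁ := c)
    (by rwa [L.mul_unit]) (L.mem_chartDomain _) (L.mem_chartDomain _) (X (L.src b)).2
  rw [L.mul_unit] at h1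
  exact h1.symm

theorem leftExtend_unit (X : ∀ p : M, L.algebroidFiber p) (p : M) :
    L.leftExtend X (L.unit p) = X p := by
  refine Subtype.ext ((L.leftExtend_val X (L.src_unit p) (L.mem_chartDomain _)).trans ?_)
  exact L.translate_unit (L.tgt_unit p) (L.mem_chartDomain _) (X p).2

/-- Left translation does not change the image under s_*, so X̃ is s-related to ρ(X). -/
theorem srcDeriv_leftExtend (X : ∀ p : M, L.algebroidFiber p) (g : G) :
    L.srcDeriv g (L.leftExtend X g).1 = L.anchor (L.src g) (X (L.src g)) := by
  have h1 := L.srcDeriv_translate (L.tgt_unit (L.src g)).symm (L.mem_chartDomain _)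
    (X (L.src g)).2
  rw [L.mul_unit] at h1
  have key : ∀ (p q : M) (h : p = q) (v : TangentSpace 𝓘(ℝ, E') p),
      ((h ▸ v : TangentSpace 𝓘(ℝ, E') q) : E') = v := by
    rintro _ _ rfl v; rfl
  exact (congrArg _ (L.leftExtend_val X rfl (L.mem_chartDomain _))).trans
    (h1.trans (key _ _ (L.src_unit (L.src g)) _).symm)

/-! ### Smooth dependence of left translation on parameters. -/

section Smooth

variable {D N : Type*} [NormedAddCommGroup D] [NormedSpace ℝ D] [TopologicalSpace N]
  [ChartedSpace D N] [IsManifold 𝓘(ℝ, D) ∞ N]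

/-- A map to the tangent bundle of `G`, given by its base point and its vector. -/
def tangentMk (b : N → G) (Z : N → E) (n : N) : TangentBundle 𝓘(ℝ, E) G := ⟨b n, Z n⟩

theorem tangentMk_congr {b b' : N → G} {Z Z' : N → E} {n : N} (h : b n = b' n)
    (h' : Z n = Z' n) : tangentMk b Z n = tangentMk b' Z' n := by
  unfold tangentMk
  rw [h', h]

theorem contMDiffAt_of_tangentMk {b : N → G} {Z : N → E} {n : N}
    (h : ContMDiffAt 𝓘(ℝ, D) 𝓘(ℝ, E).tangent ∞ (tangentMk b Z) n) :
    ContMDiffAt 𝓘(ℝ, D) 𝓘(ℝ, E) ∞ b n :=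
  (Bundle.contMDiffAt_totalSpace.1 h).1

theorem contMDiffAt_coordDeriv {b : N → G} {Z : N → E} {n : N} {c : G}
    (h : ContMDiffAt 𝓘(ℝ, D) 𝓘(ℝ, E).tangent ∞ (tangentMk b Z) n) (hc : b n ∈ L.chartDomain c) :
    ContMDiffAt 𝓘(ℝ, D) 𝓘(ℝ, L.FiberModel) ∞ (fun m ↦ L.coordDeriv c (b m) (Z m)) n := by
  have h1 := (L.contMDiffOn_coord c).contMDiffOn_tangentMapWithin (m := ∞) (by simp)
    (L.isOpen_chartDomain c).uniqueMDiffOn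
  have hopen : IsOpen (Bundle.TotalSpace.proj (F := E) (E := TangentSpace 𝓘(ℝ, E) (M := G)) ⁻¹'
      L.chartDomain c) :=
    (L.isOpen_chartDomain c).preimage (FiberBundle.continuous_proj E (TangentSpace 𝓘(ℝ, E)))
  have h2 := ContMDiffAt.comp n (f := tangentMk b Z)
    (h1.contMDiffAt (hopen.mem_nhds (x := tangentMk b Z n) hc)) h
  have h3 := ContMDiffAt.comp n
    (contMDiff_snd_tangentBundle_modelSpace L.FiberModel 𝓘(ℝ, L.FiberModel) (n := ∞)).contMDiffAt h2
  refine h3.congr_of_eventuallyEq ?_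
  filter_upwards [(contMDiffAt_of_tangentMk h).continuousAt.preimage_mem_nhds
    ((L.isOpen_chartDomain c).mem_nhds hc)] with m hm
  have : mfderivWithin 𝓘(ℝ, E) 𝓘(ℝ, L.FiberModel) (L.coord c) (L.chartDomain c) (b m) =
    L.coordDeriv c (b m) := mfderivWithin_of_isOpen (L.isOpen_chartDomain c) hm
  exact (congrArg (fun A ↦ A (Z m)) this).symm

/-- A partial derivative of a jointly smooth map is smooth in the parameters; here it is applied to
a smoothly varying vector. -/
theorem contMDiffAt_mulSliceDeriv {a : N → G} {w u : N → L.FiberModel} {n : N} {c : G}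
    (ha : ContMDiffAt 𝓘(ℝ, D) 𝓘(ℝ, E) ∞ a n)
    (hw : ContMDiffAt 𝓘(ℝ, D) 𝓘(ℝ, L.FiberModel) ∞ w n)
    (hu : ContMDiffAt 𝓘(ℝ, D) 𝓘(ℝ, L.FiberModel) ∞ u n)
    (hc : (L.src (a n), w n) ∈ L.sliceDomain c) :
    ContMDiffAt 𝓘(ℝ, D) 𝓘(ℝ, E).tangent ∞
      (tangentMk (fun m ↦ L.mulSlice c (a m) (w m))
        (fun m ↦ L.mulSliceDeriv c (a m) (w m) (u m))) n := by
  have h1 : ContMDiffAt (𝓘(ℝ, D).prod 𝓘(ℝ, L.FiberModel)) 𝓘(ℝ, E) ∞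
      (Function.uncurry fun m ↦ L.mulSlice c (a m)) (n, w n) :=
    ContMDiffAt.comp (n, w n) (g := Function.uncurry (L.mulSlice c))
      (f := fun x : N × L.FiberModel ↦ (a x.1, x.2)) (L.contMDiffAt_mulSlice hc)
      ((ContMDiffAt.comp (n, w n) (g := a) ha contMDiffAt_fst).prodMk contMDiffAt_snd)
  have h2 := h1.mfderiv (m := ∞) (fun m ↦ L.mulSlice c (a m)) w hw (by simp)
  have h3 : ContMDiffAt 𝓘(ℝ, D) 𝓘(ℝ, L.FiberModel).tangent ∞
      (fun m ↦ (⟨w m, u m⟩ : TangentBundle 𝓘(ℝ, L.FiberModel) L.FiberModel)) n := by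
    apply Bundle.contMDiffAt_totalSpace.2
    refine ⟨hw, ?_⟩
    convert! hu with y
    simp
  have h4 : ContMDiffAt 𝓘(ℝ, D) 𝓘(ℝ, E) ∞ (fun m ↦ L.mulSlice c (a m) (w m)) n :=
    ContMDiffAt.comp n (g := Function.uncurry (L.mulSlice c))
      (L.contMDiffAt_mulSlice hc) (ha.prodMk hw)
  have h5 := ContMDiffAt.clm_apply_of_inCoordinates (F₁ := L.FiberModel) (F₂ := E)
    (E₁ := TangentSpace 𝓘(ℝ, L.FiberModel) (M := L.FiberModel))
    (E₂ := TangentSpace 𝓘(ℝ, E) (M := G)) (b₁ := w)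
    (b₂ := fun m ↦ L.mulSlice c (a m) (w m)) (v := u)
    (ϕ := fun m ↦ mfderiv 𝓘(ℝ, L.FiberModel) 𝓘(ℝ, E) (L.mulSlice c (a m)) (w m)) h2 h3 h4
  exact h5

/-- The left translates of a smooth family of vertical vectors by a smooth family of elements
depend smoothly on the parameter. -/
theorem contMDiffAt_translate {a b : N → G} {Z : N → E} {n : N} {c : N → G}
    (ha : ContMDiffAt 𝓘(ℝ, D) 𝓘(ℝ, E) ∞ a n)
    (hZ : ContMDiffAt 𝓘(ℝ, D) 𝓘(ℝ, E).tangent ∞ (tangentMk b Z) n)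
    (hc : ∀ᶠ m in 𝓝 n, b m ∈ L.chartDomain (c m))
    (hab : ∀ᶠ m in 𝓝 n, L.src (a m) = L.tgt (b m)) (hv : ∀ᶠ m in 𝓝 n, L.IsVert (b m) (Z m)) :
    ContMDiffAt 𝓘(ℝ, D) 𝓘(ℝ, E).tangent ∞
      (tangentMk (fun m ↦ L.mul (a m) (b m)) (fun m ↦ L.translate (c m) (a m) (b m) (Z m))) n := by
  have hb := contMDiffAt_of_tangentMk hZ
  have h0 := L.mem_chartDomain (b n)
  have h1 : (L.src (a n), L.coord (b n) (b n)) ∈ L.sliceDomain (b n) := by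
    rw [hab.self_of_nhds]; exact L.mem_sliceDomain h0
  -- The centres `c m` may vary arbitrarily with m. Smoothness is proved in the fixed slice at `b
  -- n`, and `translate_eq` identifies the two.
  have h2 := L.contMDiffAt_mulSliceDeriv ha
    (ContMDiffAt.comp n (L.contMDiffAt_coord h0) hb) (L.contMDiffAt_coordDeriv hZ h0) h1
  refine h2.congr_of_eventuallyEq ?_
  filter_upwards [hab, hv, hc, hb.continuousAt.preimage_mem_nhds
    ((L.isOpen_chartDomain (b n)).mem_nhds h0)] with m hm1 hm2 hm3 hm4
  have e1 : L.mul (a m) (b m) = L.mulSlice (b n) (a m) (L.coord (b n) (b m)) := by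
    unfold mulSlice
    rw [hm1, L.slice_coord hm4]
  exact tangentMk_congr e1 (L.translate_eq hm1 hm3 hm4 hm2)

end Smooth

theorem contMDiffAt_leftExtend {X : ∀ p : M, L.algebroidFiber p} {g : G}
    (hX : ContMDiffAt 𝓘(ℝ, E') 𝓘(ℝ, E).tangent ∞ (tangentMk L.unit fun p ↦ (X p).1) (L.src g)) :
    ContMDiffAt 𝓘(ℝ, E) 𝓘(ℝ, E).tangent ∞
      (tangentMk (fun g : G ↦ g) fun g ↦ (L.leftExtend X g).1) g := by
  have h1 := L.contMDiffAt_translate (a := fun g : G ↦ g) (n := g) (c := fun g ↦ L.unit (L.src g))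
    (b := fun g ↦ L.unit (L.src g)) (Z := fun g ↦ (X (L.src g)).1) contMDiffAt_id
    (ContMDiffAt.comp g hX (L.contMDiff_src g))
    (Filter.Eventually.of_forall fun m ↦ L.mem_chartDomain _)
    (Filter.Eventually.of_forall fun m ↦ (L.tgt_unit _).symm)
    (Filter.Eventually.of_forall fun m ↦ (X (L.src m)).2)
  refine h1.congr_of_eventuallyEq (Filter.Eventually.of_forall fun m ↦ ?_)
  exact tangentMk_congr (L.mul_unit m).symm (L.leftExtend_val X rfl (L.mem_chartDomain _))

/-! ### Left-invariant forms and restriction to the units. -/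

/-- Left invariance of a section of `⋀^k (T^t G)^*`. -/
def IsLeftInvariant {k : ℕ} (θ : ∀ g : G, L.vert g [⋀^Fin k]→L[ℝ] ℝ) : Prop :=
  ∀ g : G, formPullback (L.leftMul g) (L.fiberForm θ (L.tgt g)) = L.fiberForm θ (L.src g)

theorem isLeftInvariant_iff {k : ℕ} {θ : ∀ g : G, L.vert g [⋀^Fin k]→L[ℝ] ℝ} :
    L.IsLeftInvariant θ ↔ ∀ (g : G) (x : L.Fiber (L.src g)) (v : Fin k → L.vert x.1),
      θ (L.mul g x.1) (fun i ↦ L.leftTranslate g x (v i)) = θ x.1 v := by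
  constructor
  · intro h g x v
    choose u hu using fun i ↦ (L.inclDeriv_bijective x).2 (v i)
    have h1 := congrArg (fun A ↦ A u) (congrFun (h g) x)
    have h2 : v = fun i ↦ L.inclDeriv x (u i) := funext fun i ↦ (hu i).symm
    rw [h2]
    refine Eq.trans (congrArg _ (funext fun i ↦ ?_)) h1
    exact L.leftTranslate_inclDeriv x (u i)
  · intro h g
    funext x
    ext u
    have h1 := h g x fun i ↦ L.inclDeriv x (u i)
    rw [funext fun i ↦ L.leftTranslate_inclDeriv x (u i)] at h1
    exact h1

theorem IsLeftInvariant.apply_eq {k : ℕ} {θ : ∀ g : G, L.vert g [⋀^Fin k]→L[ℝ] ℝ}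
    (hθ : L.IsLeftInvariant θ) {a b d c : G} (h : L.src a = L.tgt b) (hc : b ∈ L.chartDomain c)
    (hd : L.mul a b = d) {v : Fin k → L.vert b} {v' : Fin k → L.vert d}
    (hv : ∀ i, ((v' i).1 : E) = L.translate c a b (v i).1) : θ d v' = θ b v := by
  refine Eq.trans ?_ (L.isLeftInvariant_iff.1 hθ a ⟨b, h.symm⟩ v)
  exact L.form_congr θ hd.symm fun i ↦
    (hv i).trans (L.leftTranslate_val (g := a) ⟨b, h.symm⟩ hc (v i)).symm

/-- On left-invariant fields an invariant form gives a function pulled back from M by s. -/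
theorem IsLeftInvariant.apply_leftExtend {k : ℕ} {θ : ∀ g : G, L.vert g [⋀^Fin k]→L[ℝ] ℝ}
    (hθ : L.IsLeftInvariant θ) (X : Fin k → ∀ p : M, L.algebroidFiber p) (g : G) :
    θ g (fun i ↦ L.leftExtend (X i) g) = θ (L.unit (L.src g)) fun i ↦ X i (L.src g) :=
  hθ.apply_eq L (L.tgt_unit _).symm (L.mem_chartDomain _) (L.mul_unit g)
    fun i ↦ L.leftExtend_val (X i) rfl (L.mem_chartDomain _)

theorem smoothForm_restrict {k : ℕ} {θ : ∀ g : G, L.vert g [⋀^Fin k]→L[ℝ] ℝ}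
    (hθ : L.SmoothForm (D := E) (fun g : G ↦ g) θ) :
    L.SmoothForm (D := E') L.unit fun p ↦ θ (L.unit p) := by
  intro U hU X hX
  -- Test sections over U extend left-invariantly to s⁻¹(U), where smoothness of θ can be used;
  -- composing with the unit map returns to U.
  have h1 := hθ (L.src ⁻¹' U) (hU.preimage L.contMDiff_src.continuous)
    (fun i ↦ L.leftExtend (X i)) fun i g hg ↦
      (L.contMDiffAt_leftExtend ((hX i).contMDiffAt (hU.mem_nhds hg))).contMDiffWithinAt
  have h2 := h1.comp (L.contMDiff_unit.contMDiffOn (s := U))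
    fun p hp ↦ by simpa [L.src_unit] using hp
  refine h2.congr fun p _ ↦ ?_
  exact congrArg _ (funext fun i ↦ (L.leftExtend_unit (X i) p).symm)

theorem isVert_mulSliceDeriv {c a : G} {w : L.FiberModel} (h : (L.src a, w) ∈ L.sliceDomain c)
    (u : L.FiberModel) : L.IsVert (L.mulSlice c a w) (L.mulSliceDeriv c a w u) := by
  have h1 := HasMFDerivAt.comp w
    ((L.contMDiff_tgt (L.mulSlice c a w)).mdifferentiableAt (by simp)).hasMFDerivAt
    (L.hasMFDerivAt_mulSlice h)
  have h2 : L.tgt ∘ L.mulSlice c a =ᶠ[𝓝 w] fun _ ↦ L.tgt a := by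
    have : Continuous fun w : L.FiberModel ↦ (L.src a, w) := by fun_prop
    filter_upwards [((L.isOpen_sliceDomain c).preimage this).mem_nhds h] with y hy
    exact L.tgt_mul _ _ (L.tgt_slice hy).symm
  have h3 := hasMFDerivAt_unique h1
    ((hasMFDerivAt_const (I := 𝓘(ℝ, L.FiberModel)) (I' := 𝓘(ℝ, E')) (L.tgt a)
      w).congr_of_eventuallyEq h2)
  exact congrArg (fun A ↦ A u) h3

theorem mulSlice_unit {c g : G} (h : g ∈ L.chartDomain c) :
    L.mulSlice c (L.unit (L.tgt g)) (L.coord c g) = g := by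
  unfold mulSlice
  rw [L.src_unit, L.slice_coord h, L.unit_mul]

theorem unit_mem_sliceDomain {c g : G} (h : g ∈ L.chartDomain c) :
    (L.src (L.unit (L.tgt g)), L.coord c g) ∈ L.sliceDomain c := by
  rw [L.src_unit]; exact L.mem_sliceDomain h

/-! ### Local frames and the invariant extension of a form. -/

open Classical in
/-- The local trivialization of `T^t G` over `L.chartDomain c` given by the slice coordinate. -/
def frame (c g : G) : L.FiberModel →ₗ[ℝ] L.vert g :=
  if h : g ∈ L.chartDomain c then
    LinearMap.codRestrict (L.vert g)
      (L.mulSliceDeriv c (L.unit (L.tgt g)) (L.coord c g)).toLinearMap fun u ↦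
        (congrArg (fun g' ↦ L.IsVert g' (L.mulSliceDeriv c (L.unit (L.tgt g)) (L.coord c g) u))
          (L.mulSlice_unit h)).mp (L.isVert_mulSliceDeriv (L.unit_mem_sliceDomain h) u)
  else 0

theorem frame_val {c g : G} (h : g ∈ L.chartDomain c) (u : L.FiberModel) :
    ((L.frame c g u).1 : E) = L.mulSliceDeriv c (L.unit (L.tgt g)) (L.coord c g) u := by
  rw [frame, dif_pos h]; rfl

/-- The composite is left translation by a unit, hence the identity on vertical vectors. -/
theorem frame_coordDeriv {c g : G} (h : g ∈ L.chartDomain c) (v : L.vert g) :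
    L.frame c g (L.coordDeriv c g v.1) = v :=
  Subtype.ext ((L.frame_val h _).trans (L.translate_unit rfl h v.2))

section

variable {D N : Type*} [NormedAddCommGroup D] [NormedSpace ℝ D] [TopologicalSpace N]
  [ChartedSpace D N] [IsManifold 𝓘(ℝ, D) ∞ N]

theorem contMDiffAt_frame {b : N → G} {n : N} {c : G} (hb : ContMDiffAt 𝓘(ℝ, D) 𝓘(ℝ, E) ∞ b n)
    (hc : b n ∈ L.chartDomain c) (u : L.FiberModel) :
    ContMDiffAt 𝓘(ℝ, D) 𝓘(ℝ, E).tangent ∞ (tangentMk b fun m ↦ (L.frame c (b m) u).1) n := by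
  have h1 := L.contMDiffAt_mulSliceDeriv (n := n) (c := c)
    (a := fun m ↦ L.unit (L.tgt (b m))) (w := fun m ↦ L.coord c (b m)) (u := fun _ ↦ u)
    (ContMDiffAt.comp n (L.contMDiff_unit _) (ContMDiffAt.comp n (L.contMDiff_tgt _) hb))
    (ContMDiffAt.comp n (g := L.coord c) (L.contMDiffAt_coord hc) hb) contMDiffAt_const
    (L.unit_mem_sliceDomain hc)
  refine h1.congr_of_eventuallyEq ?_
  filter_upwards [hb.continuousAt.preimage_mem_nhds ((L.isOpen_chartDomain c).mem_nhds hc)]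
    with m hm
  exact tangentMk_congr (L.mulSlice_unit hm).symm (L.frame_val hm u)

end

/-- The point g supplies a submersion chart, which embeds the fibre model linearly in E. -/
theorem finiteDimensional_fiberModel [FiniteDimensional ℝ E] (g : G) :
    FiniteDimensional ℝ L.FiberModel :=
  Module.Finite.of_injective ((L.submersionAt g).equiv.symm.toLinearMap ∘ₗ
    LinearMap.inr ℝ E' L.FiberModel)
    ((L.submersionAt g).equiv.symm.injective.comp LinearMap.inr_injective)

/-- The differential of left multiplication by `g⁻¹`, from `(T^t G)_g` to `(AG)_{s(g)}`. -/
def toUnit (g : G) : L.vert g →L[ℝ] L.algebroidFiber (L.src g) :=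
  ((L.translate g (L.inv g) g).comp (L.vert g).subtypeL).codRestrict _ fun v ↦
    (congrArg (fun g' ↦ L.IsVert g' (L.translate g (L.inv g) g v.1)) (L.inv_mul g)).mp
      (L.isVert_translate (L.src_inv g) (L.mem_chartDomain g) v.2)

theorem toUnit_val (g : G) (v : L.vert g) :
    ((L.toUnit g v).1 : E) = L.translate g (L.inv g) g v.1 := rfl

/-- The left-invariant section of `⋀^k (T^t G)^*` that extends a section of `⋀^k (AG)^*`. -/
def extendForm {k : ℕ} (η : ∀ p : M, L.algebroidFiber p [⋀^Fin k]→L[ℝ] ℝ) (g : G) :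
    L.vert g [⋀^Fin k]→L[ℝ] ℝ :=
  (η (L.src g)).compContinuousLinearMap (L.toUnit g)

theorem algebroidForm_congr {k : ℕ} (η : ∀ p : M, L.algebroidFiber p [⋀^Fin k]→L[ℝ] ℝ) {p q : M}
    (h : p = q) {v : Fin k → L.algebroidFiber p} {v' : Fin k → L.algebroidFiber q}
    (hv : ∀ i, ((v i).1 : E) = (v' i).1) : η p v = η q v' := by
  subst h
  exact congrArg _ (funext fun i ↦ Subtype.ext (hv i))

theorem isLeftInvariant_extendForm {k : ℕ} (η : ∀ p : M, L.algebroidFiber p [⋀^Fin k]→L[ℝ] ℝ) :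
    L.IsLeftInvariant (L.extendForm η) := by
  refine L.isLeftInvariant_iff.2 fun g x v ↦ ?_
  have hx : L.src g = L.tgt x.1 := x.2.symm
  refine L.algebroidForm_congr η (L.src_mul g x.1 hx) fun i ↦ ?_
  change L.translate (L.mul g x.1) (L.inv (L.mul g x.1)) (L.mul g x.1)
    (L.leftTranslate g x (v i)).1 = L.translate x.1 (L.inv x.1) x.1 (v i).1
  have h1 := L.leftTranslate_val x (L.mem_chartDomain x.1) (v i)
  refine (congrArg (L.translate (L.mul g x.1) (L.inv (L.mul g x.1)) (L.mul g x.1)) h1).trans ?_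
  have hs : L.src (L.inv (L.mul g x.1)) = L.tgt g := by rw [L.src_inv, L.tgt_mul g x.1 hx]
  have h2 := L.translate_translate (a := L.inv (L.mul g x.1)) (b := g) (d := x.1) hs hx
    (L.mem_chartDomain (L.mul g x.1)) (L.mem_chartDomain x.1) (L.mem_chartDomain x.1) (v i).2
  rw [h2]
  -- Multiplying by x on the right gives the unit at s(x), so cancelling x on the right gives
  -- (gx)⁻¹g = x⁻¹.
  have h3 : L.mul (L.inv (L.mul g x.1)) g = L.inv x.1 := by
    have e1 : L.mul (L.mul (L.inv (L.mul g x.1)) g) x.1 = L.unit (L.src x.1) := by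
      rw [L.mul_assoc _ _ _ hs hx, L.inv_mul, L.src_mul g x.1 hx]
    have e2 : L.src (L.mul (L.inv (L.mul g x.1)) g) = L.tgt x.1 := (L.src_mul _ _ hs).trans hx
    have e3 := L.mul_assoc _ x.1 (L.inv x.1) e2 (L.tgt_inv x.1).symm
    rw [e1, L.mul_inv, ← e2, L.mul_unit, ← L.tgt_inv x.1, L.unit_mul] at e3
    exact e3.symm
  rw [h3]

theorem extendForm_unit {k : ℕ} (η : ∀ p : M, L.algebroidFiber p [⋀^Fin k]→L[ℝ] ℝ) (p : M) :
    L.extendForm η (L.unit p) = η p := by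
  ext v
  refine L.algebroidForm_congr η (L.src_unit p) fun i ↦ ?_
  change L.translate (L.unit p) (L.inv (L.unit p)) (L.unit p) (v i).1 = (v i).1
  have h1 : L.inv (L.unit p) = L.unit p := by
    have h2 := L.inv_mul (L.unit p)
    have h3 := L.mul_unit (L.inv (L.unit p))
    rw [L.src_inv, L.tgt_unit] at h3
    rw [L.src_unit, h3] at h2
    exact h2
  rw [h1]
  exact L.translate_unit (L.tgt_unit p) (L.mem_chartDomain _) (v i).2

theorem extendForm_restrict {k : ℕ} {θ : ∀ g : G, L.vert g [⋀^Fin k]→L[ℝ] ℝ}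
    (hθ : L.IsLeftInvariant θ) : L.extendForm (fun p ↦ θ (L.unit p)) = θ := by
  funext g
  ext v
  exact hθ.apply_eq L (L.src_inv g) (L.mem_chartDomain g) (L.inv_mul g) fun i ↦ rfl

/-- Smoothness of η is known only for sections over M, whereas the vectors translated back to the
units depend on g and not just on s(g). Expanding them in a frame over M separates the two: the
coefficients are smooth in g, and η on frame fields is a smooth function composed with s. -/
theorem smoothForm_extendForm [FiniteDimensional ℝ E] {k : ℕ}
    {η : ∀ p : M, L.algebroidFiber p [⋀^Fin k]→L[ℝ] ℝ}
    (hη : L.SmoothForm (D := E') L.unit η) :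
    L.SmoothForm (D := E) (fun g : G ↦ g) (L.extendForm η) := by
  intro U hU Y hY g hg
  have := L.finiteDimensional_fiberModel g
  let β := Module.finBasis ℝ L.FiberModel
  set c := L.unit (L.src g) with hc
  have hcu : Continuous fun g' ↦ L.unit (L.src g') :=
    L.contMDiff_unit.continuous.comp L.contMDiff_src.continuous
  have hT (i : Fin k) : ContMDiffAt 𝓘(ℝ, E) 𝓘(ℝ, E).tangent ∞
      (tangentMk (fun g ↦ L.unit (L.src g)) fun g ↦ (L.toUnit g (Y i g)).1) g := by
    have h1 := L.contMDiffAt_translate (a := L.inv) (n := g) (c := fun g ↦ g)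
      (b := fun g ↦ g) (Z := fun g ↦ (Y i g).1) (L.contMDiff_inv g)
      ((hY i).contMDiffAt (hU.mem_nhds hg))
      (Filter.Eventually.of_forall fun m ↦ L.mem_chartDomain _)
      (Filter.Eventually.of_forall fun m ↦ L.src_inv m)
      (Filter.Eventually.of_forall fun m ↦ (Y i m).2)
    refine h1.congr_of_eventuallyEq (Filter.Eventually.of_forall fun m ↦ ?_)
    exact tangentMk_congr (L.inv_mul m).symm (L.toUnit_val m (Y i m))
  have hcoef (i : Fin k) (j) : ContMDiffAt 𝓘(ℝ, E) 𝓘(ℝ, ℝ) ∞ (fun g ↦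
      β.repr (L.coordDeriv c (L.unit (L.src g)) (L.toUnit g (Y i g)).1) j) g :=
    ContMDiffAt.comp g (g := (β.coord j).toContinuousLinearMap)
      (β.coord j).toContinuousLinearMap.contMDiff.contMDiffAt
      (L.contMDiffAt_coordDeriv (hT i) (L.mem_chartDomain c))
  have hform (r : Fin k → Fin (Module.finrank ℝ L.FiberModel)) :
      ContMDiffAt 𝓘(ℝ, E) 𝓘(ℝ, ℝ) ∞
        (fun g ↦ η (L.src g) fun i ↦ L.frame c (L.unit (L.src g)) (β (r i))) g := by
    have h1 := hη (L.unit ⁻¹' L.chartDomain c)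
      ((L.isOpen_chartDomain c).preimage L.contMDiff_unit.continuous)
      (fun i p ↦ L.frame c (L.unit p) (β (r i))) fun i p hp ↦
        (L.contMDiffAt_frame (L.contMDiff_unit p) hp (β (r i))).contMDiffWithinAt
    exact ContMDiffAt.comp g (g := fun p ↦ η p fun i ↦ L.frame c (L.unit p) (β (r i)))
      (h1.contMDiffAt (((L.isOpen_chartDomain c).preimage
        L.contMDiff_unit.continuous).mem_nhds (L.mem_chartDomain c))) (L.contMDiff_src g)
  have hsum : ContMDiffAt 𝓘(ℝ, E) 𝓘(ℝ, ℝ) ∞ (fun g ↦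
      ∑ r : Fin k → Fin (Module.finrank ℝ L.FiberModel),
        (∏ i, β.repr (L.coordDeriv c (L.unit (L.src g)) (L.toUnit g (Y i g)).1) (r i)) *
          η (L.src g) fun i ↦ L.frame c (L.unit (L.src g)) (β (r i))) g :=
    contMDiffAt_finsetSum fun r _ ↦
      (contMDiffAt_finsetProd fun i _ ↦ hcoef i (r i)).mul (hform r)
  refine (hsum.congr_of_eventuallyEq ?_).contMDiffWithinAt
  filter_upwards [((L.isOpen_chartDomain c).preimage hcu).mem_nhds
    (L.mem_chartDomain c)] with m hm
  have h1 (i : Fin k) : L.toUnit m (Y i m) = ∑ j,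
      β.repr (L.coordDeriv c (L.unit (L.src m)) (L.toUnit m (Y i m)).1) j •
        L.frame c (L.unit (L.src m)) (β j) := by
    conv_lhs => rw [← L.frame_coordDeriv hm (L.toUnit m (Y i m)),
      ← β.sum_repr (L.coordDeriv c (L.unit (L.src m)) (L.toUnit m (Y i m)).1)]
    simp only [map_sum, map_smul]
  change η (L.src m) (fun i ↦ L.toUnit m (Y i m)) = _
  rw [show (fun i ↦ L.toUnit m (Y i m)) = _ from funext h1]
  -- Multilinear expansion over all choices r of one basis index per slot.
  refine ((η (L.src m)).toMultilinearMap.map_sum _).trans (Finset.sum_congr rfl fun r _ ↦ ?_)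
  exact (η (L.src m)).toMultilinearMap.map_smul_univ _ _

/-- Restriction to the units, as a linear equivalence from left-invariant sections of
`⋀^k (T^t G)^*` to sections of `⋀^k (AG)^*`. -/
def restrictEquiv [FiniteDimensional ℝ E] (k : ℕ) :
    L.leftInvariantForms k ≃ₗ[ℝ] L.algebroidForms k where
  toFun θ := ⟨fun p ↦ θ.1 (L.unit p), L.smoothForm_restrict θ.2.1⟩
  map_add' _ _ := rfl
  map_smul' _ _ := rfl
  invFun η := ⟨L.extendForm η.1, L.smoothForm_extendForm η.2, L.isLeftInvariant_extendForm η.1⟩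
  left_inv θ := Subtype.ext (L.extendForm_restrict θ.2.2)
  right_inv η := Subtype.ext (funext fun p ↦ L.extendForm_unit η.1 p)

end LieGroupoid

/-! ### Naturality of the Lie bracket for related vector fields. -/

section Related

open VectorField

/-- The terms with the second derivative of f cancel by its symmetry; what remains is the chain rule
for V' ∘ f and W' ∘ f. -/
theorem fderiv_lieBracket_of_related {F K : Type*} [NormedAddCommGroup F] [NormedSpace ℝ F]
    [NormedAddCommGroup K] [NormedSpace ℝ K] {f : F → K} {V W : F → F} {V' W' : K → K} {x : F}
    (hf : ContDiffAt ℝ 2 f x) (hV : DifferentiableAt ℝ V x) (hW : DifferentiableAt ℝ W x)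
    (hV' : DifferentiableAt ℝ V' (f x)) (hW' : DifferentiableAt ℝ W' (f x))
    (hVV' : ∀ᶠ z in 𝓝 x, fderiv ℝ f z (V z) = V' (f z))
    (hWW' : ∀ᶠ z in 𝓝 x, fderiv ℝ f z (W z) = W' (f z)) :
    fderiv ℝ f x (lieBracket ℝ V W x) = lieBracket ℝ V' W' (f x) := by
  have hfd : DifferentiableAt ℝ f x := hf.differentiableAt (by simp)
  rw [fderiv_apply_lieBracket hf (by simp) hW hV, Filter.EventuallyEq.fderiv_eq hVV',
    Filter.EventuallyEq.fderiv_eq hWW', fderiv_fun_comp x hV' hfd, fderiv_fun_comp x hW' hfd]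
  simp only [ContinuousLinearMap.comp_apply, hVV'.self_of_nhds, hWW'.self_of_nhds, lieBracket]

/-- The derivative of a map of manifolds, as a linear map of the model spaces. -/
def modelDeriv {K K' N N' : Type*} [NormedAddCommGroup K] [NormedSpace ℝ K] [TopologicalSpace N]
    [ChartedSpace K N] [NormedAddCommGroup K'] [NormedSpace ℝ K'] [TopologicalSpace N']
    [ChartedSpace K' N'] (f : N → N') (x : N) : K →L[ℝ] K' :=
  mfderiv 𝓘(ℝ, K) 𝓘(ℝ, K') f x

variable {F K N : Type*} [NormedAddCommGroup F] [NormedSpace ℝ F]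
  [NormedAddCommGroup K] [NormedSpace ℝ K] [TopologicalSpace N] [ChartedSpace K N]
  [IsManifold 𝓘(ℝ, K) ∞ N]

/-- A vector field read in the chart at `x`. -/
def chartField (x : N) (V : ∀ y : N, TangentSpace 𝓘(ℝ, K) y) : K → K :=
  mpullbackWithin 𝓘(ℝ, K) 𝓘(ℝ, K) (extChartAt 𝓘(ℝ, K) x).symm V (range 𝓘(ℝ, K))

/-- Pullback by the inverse chart inverts its derivative, and that inverse is the derivative of the
chart. -/
theorem chartField_apply (x : N) (V : ∀ y : N, TangentSpace 𝓘(ℝ, K) y) {y : N}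
    (hy : y ∈ (extChartAt 𝓘(ℝ, K) x).source) :
    chartField x V (extChartAt 𝓘(ℝ, K) x y) =
      (modelDeriv (K := K) (K' := K) (extChartAt 𝓘(ℝ, K) x) y) (V y) := by
  let A : K →L[ℝ] K := mfderivWithin 𝓘(ℝ, K) 𝓘(ℝ, K) (extChartAt 𝓘(ℝ, K) x).symm
    (range 𝓘(ℝ, K)) (extChartAt 𝓘(ℝ, K) x y)
  have h1 : A.inverse = modelDeriv (K := K) (K' := K) (extChartAt 𝓘(ℝ, K) x) y :=
    ContinuousLinearMap.inverse_eq
      (mfderivWithin_extChartAt_symm_comp_mfderiv_extChartAt' hy)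
      (mfderiv_extChartAt_comp_mfderivWithin_extChartAt_symm' hy)
  have h2 : (V ((extChartAt 𝓘(ℝ, K) x).symm (extChartAt 𝓘(ℝ, K) x y)) : K) = V y := by
    rw [(extChartAt 𝓘(ℝ, K) x).left_inv hy]
  change A.inverse (V ((extChartAt 𝓘(ℝ, K) x).symm (extChartAt 𝓘(ℝ, K) x y)) : K) = _
  exact (congrArg _ h2).trans (congrArg (fun A : K →L[ℝ] K ↦ A (V y)) h1)

theorem differentiableAt_chartField [CompleteSpace K] {x : N}
    {V : ∀ y : N, TangentSpace 𝓘(ℝ, K) y}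
    (hV : MDifferentiableAt 𝓘(ℝ, K) 𝓘(ℝ, K).tangent
      (fun y ↦ (⟨y, V y⟩ : TangentBundle 𝓘(ℝ, K) N)) x) :
    DifferentiableAt ℝ (chartField x V) (extChartAt 𝓘(ℝ, K) x x) := by
  have h := MDifferentiableWithinAt.differentiableWithinAt_mpullbackWithin_vectorField
    hV.mdifferentiableWithinAt (s := univ)
  have h2 : (extChartAt 𝓘(ℝ, K) x).symm ⁻¹' univ ∩ range 𝓘(ℝ, K) = univ := by simp
  rw [h2] at h
  exact h.differentiableAt Filter.univ_mem

theorem mlieBracket_eq_chartField (x : N) (V W : ∀ y : N, TangentSpace 𝓘(ℝ, K) y) :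
    (mlieBracket 𝓘(ℝ, K) V W x : K) = ContinuousLinearMap.inverse
      (modelDeriv (K := K) (K' := K) (extChartAt 𝓘(ℝ, K) x) x)
        (lieBracket ℝ (chartField x V) (chartField x W) (extChartAt 𝓘(ℝ, K) x x)) := by
  have h2 : (extChartAt 𝓘(ℝ, K) x).symm ⁻¹' univ ∩ range 𝓘(ℝ, K) = univ := by simp
  change ContinuousLinearMap.inverse
      (modelDeriv (K := K) (K' := K) (extChartAt 𝓘(ℝ, K) x) x)
    (lieBracketWithin ℝ (chartField x V) (chartField x W)
      ((extChartAt 𝓘(ℝ, K) x).symm ⁻¹' univ ∩ range 𝓘(ℝ, K)) (extChartAt 𝓘(ℝ, K) x x)) = _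
  rw [h2, lieBracketWithin_univ]

/-- The Lie bracket is natural for vector fields related by a map from a normed space to a
manifold. -/
theorem mfderiv_lieBracket_of_related [CompleteSpace K] {f : F → N} {V W : F → F}
    {V' W' : ∀ y : N, TangentSpace 𝓘(ℝ, K) y} {x : F}
    (hf : ContMDiffAt 𝓘(ℝ, F) 𝓘(ℝ, K) ∞ f x)
    (hV : DifferentiableAt ℝ V x) (hW : DifferentiableAt ℝ W x)
    (hV' : MDifferentiableAt 𝓘(ℝ, K) 𝓘(ℝ, K).tangent
      (fun y ↦ (⟨y, V' y⟩ : TangentBundle 𝓘(ℝ, K) N)) (f x))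
    (hW' : MDifferentiableAt 𝓘(ℝ, K) 𝓘(ℝ, K).tangent
      (fun y ↦ (⟨y, W' y⟩ : TangentBundle 𝓘(ℝ, K) N)) (f x))
    (hVV' : ∀ᶠ z in 𝓝 x, (modelDeriv (K := F) (K' := K) f z) (V z) = V' (f z))
    (hWW' : ∀ᶠ z in 𝓝 x, (modelDeriv (K := F) (K' := K) f z) (W z) = W' (f z)) :
    (modelDeriv (K := F) (K' := K) f x) (lieBracket ℝ V W x) =
      mlieBracket 𝓘(ℝ, K) V' W' (f x) := by
  set e := extChartAt 𝓘(ℝ, K) (f x) with he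
  have hsrc : ∀ᶠ z in 𝓝 x, f z ∈ e.source :=
    hf.continuousAt.preimage_mem_nhds (extChartAt_source_mem_nhds (f x))
  have hmd : ∀ᶠ z in 𝓝 x, MDifferentiableAt 𝓘(ℝ, F) 𝓘(ℝ, K) f z := by
    have hf1 : ContMDiffAt 𝓘(ℝ, F) 𝓘(ℝ, K) 1 f x := hf.of_le (by simp)
    filter_upwards [(contMDiffAt_iff_contMDiffAt_nhds (by simp)).1 hf1] with z hz
    exact hz.mdifferentiableAt (by simp)
  have hder : ∀ᶠ z in 𝓝 x, fderiv ℝ (fun z ↦ e (f z)) z =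
      (modelDeriv (K := K) (K' := K) e (f z)).comp
        (modelDeriv (K := F) (K' := K) f z) := by
    filter_upwards [hsrc, hmd] with z hz1 hz2
    have h1 : MDifferentiableAt 𝓘(ℝ, K) 𝓘(ℝ, K) e (f z) :=
      (contMDiffAt_extChartAt' (n := 1) (by simpa [he] using hz1)).mdifferentiableAt (by simp)
    have h2 := HasMFDerivAt.comp z h1.hasMFDerivAt hz2.hasMFDerivAt
    have h3 : HasFDerivAt (fun z ↦ e (f z)) ((modelDeriv (K := K) (K' := K) e (f z)).comp
        (modelDeriv (K := F) (K' := K) f z)) z := hasMFDerivAt_iff_hasFDerivAt.1 h2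
    exact h3.fderiv
  have hrel {U : F → F} {U' : ∀ y : N, TangentSpace 𝓘(ℝ, K) y}
      (hU : ∀ᶠ z in 𝓝 x, (modelDeriv (K := F) (K' := K) f z) (U z) = U' (f z)) :
      ∀ᶠ z in 𝓝 x, fderiv ℝ (fun z ↦ e (f z)) z (U z) = chartField (f x) U' (e (f z)) := by
    filter_upwards [hU, hsrc, hder] with z hz1 hz2 hz3
    rw [hz3, chartField_apply (f x) U' hz2]
    exact congrArg (modelDeriv (K := K) (K' := K) e (f z)) hz1
  have hcd : ContDiffAt ℝ 2 (fun z ↦ e (f z)) x := by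
    rw [← contMDiffAt_iff_contDiffAt]
    exact ContMDiffAt.comp x (contMDiffAt_extChartAt (n := 2)) (hf.of_le ENat.LEInfty.out)
  have key := fderiv_lieBracket_of_related hcd hV hW (differentiableAt_chartField hV')
    (differentiableAt_chartField hW') (hrel hVV') (hrel hWW')
  rw [hder.self_of_nhds] at key
  have hinv : (modelDeriv (K := K) (K' := K) e (f x)).IsInvertible :=
    isInvertible_mfderiv_extChartAt (mem_extChartAt_source (f x))
  refine Eq.trans ?_ (mlieBracket_eq_chartField (f x) V' W').symm
  refine Eq.trans ?_ (congrArg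
    (ContinuousLinearMap.inverse (modelDeriv (K := K) (K' := K) e (f x))) key)
  -- The chart derivative is invertible, so it cancels against the inverse in the definition of the
  -- bracket on the manifold.
  obtain ⟨A, hA⟩ := hinv
  rw [← hA]
  simp

end Related

/-! ### Brackets of left-invariant vector fields. -/

namespace LieGroupoid

open VectorField

variable {E E' G M : Type*}
  [NormedAddCommGroup E] [NormedSpace ℝ E] [NormedAddCommGroup E'] [NormedSpace ℝ E']
  [TopologicalSpace G] [ChartedSpace E G] [IsManifold 𝓘(ℝ, E) ∞ G]
  [TopologicalSpace M] [ChartedSpace E' M] [IsManifold 𝓘(ℝ, E') ∞ M]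
  (L : LieGroupoid E E' G M)

theorem contMDiffAt_leftExtend_of_isAlgebroidSection {X : ∀ p : M, L.algebroidFiber p}
    (hX : L.IsAlgebroidSection X) (g : G) :
    ContMDiffAt 𝓘(ℝ, E) 𝓘(ℝ, E).tangent ∞
      (tangentMk (fun g : G ↦ g) fun g ↦ (L.leftExtend X g).1) g :=
  L.contMDiffAt_leftExtend (ContMDiffOn.contMDiffAt hX Filter.univ_mem)

theorem eventually_sliceDomain {c : G} {q : M} {w : L.FiberModel}
    (h : (q, w) ∈ L.sliceDomain c) : ∀ᶠ z in 𝓝 w, (q, z) ∈ L.sliceDomain c := by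
  have : Continuous fun w : L.FiberModel ↦ (q, w) := by fun_prop
  exact ((L.isOpen_sliceDomain c).preimage this).mem_nhds h

theorem contMDiffAt_slice {c : G} {q : M} {w : L.FiberModel} (h : (q, w) ∈ L.sliceDomain c) :
    ContMDiffAt 𝓘(ℝ, L.FiberModel) 𝓘(ℝ, E) ∞ (L.slice c q) w :=
  ContMDiffAt.comp (I' := 𝓘(ℝ, E').prod 𝓘(ℝ, L.FiberModel)) w
    (g := fun x : M × L.FiberModel ↦ L.slice c x.1 x.2) (f := fun w ↦ (q, w))
    ((L.contMDiffOn_slice c).contMDiffAt ((L.isOpen_sliceDomain c).mem_nhds h))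
    (contMDiffAt_const.prodMk contMDiffAt_id)

theorem mulSlice_unit_eq_slice {c : G} {q : M} {w : L.FiberModel}
    (h : (q, w) ∈ L.sliceDomain c) : L.mulSlice c (L.unit q) w = L.slice c q w := by
  unfold mulSlice
  have h1 := L.unit_mul (L.slice c q w)
  rw [L.tgt_slice h] at h1
  rw [L.src_unit, h1]

/-- The left-invariant vector field of `X`, read on `t⁻¹(q)` in the slice coordinate centred
at `c`. -/
def sliceField (c : G) (q : M) (X : ∀ p : M, L.algebroidFiber p) (w : L.FiberModel) :
    L.FiberModel :=
  L.coordDeriv c (L.slice c q w) (L.leftExtend X (L.slice c q w)).1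

theorem differentiableAt_sliceField {X : ∀ p : M, L.algebroidFiber p}
    (hX : L.IsAlgebroidSection X) {c : G} {q : M} {w : L.FiberModel}
    (h : (q, w) ∈ L.sliceDomain c) : DifferentiableAt ℝ (L.sliceField c q X) w := by
  have h1 : ContMDiffAt 𝓘(ℝ, L.FiberModel) 𝓘(ℝ, E).tangent ∞
      (tangentMk (L.slice c q) fun w ↦ (L.leftExtend X (L.slice c q w)).1) w :=
    ContMDiffAt.comp w (L.contMDiffAt_leftExtend_of_isAlgebroidSection hX _)
      (L.contMDiffAt_slice h)
  exact ((L.contMDiffAt_coordDeriv h1 (L.slice_mem h)).mdifferentiableAt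
    (by simp)).differentiableAt

/-- By left invariance, one coordinate field on t⁻¹(q) is related to X̃ through multiplication by
every a with s(a) = q. This freedom in a is what makes the bracket left-invariant. -/
theorem mulSliceDeriv_sliceField (X : ∀ p : M, L.algebroidFiber p) {a c : G} {q : M}
    {w : L.FiberModel} (ha : L.src a = q) (h : (q, w) ∈ L.sliceDomain c) :
    L.mulSliceDeriv c a w (L.sliceField c q X w) = (L.leftExtend X (L.mulSlice c a w)).1 := by
  subst ha
  have h1 := L.leftExtend_mul X (L.tgt_slice h).symm (L.slice_mem h)
  refine Eq.trans ?_ h1.symm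
  change _ = L.mulSliceDeriv c a (L.coord c (L.slice c (L.src a) w)) _
  rw [L.coord_slice h]
  rfl

theorem coordDeriv_mulSliceDeriv {c : G} {q : M} {w : L.FiberModel}
    (h : (q, w) ∈ L.sliceDomain c) (u : L.FiberModel) :
    L.coordDeriv c (L.slice c q w) (L.mulSliceDeriv c (L.unit q) w u) = u := by
  have h0 : (L.src (L.unit q), w) ∈ L.sliceDomain c := by rwa [L.src_unit]
  have hm := L.slice_mem h
  rw [← L.mulSlice_unit_eq_slice h] at hm ⊢
  have h1 := HasMFDerivAt.comp w (L.hasMFDerivAt_coord hm) (L.hasMFDerivAt_mulSlice h0)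
  have h2 : L.coord c ∘ L.mulSlice c (L.unit q) =ᶠ[𝓝 w] id := by
    filter_upwards [L.eventually_sliceDomain h] with z hz
    change L.coord c (L.mulSlice c (L.unit q) z) = z
    rw [L.mulSlice_unit_eq_slice hz, L.coord_slice hz]
  have h3 := hasMFDerivAt_unique h1
    ((hasMFDerivAt_id (I := 𝓘(ℝ, L.FiberModel)) w).congr_of_eventuallyEq h2)
  exact congrArg (fun A ↦ A u) h3

/-- The Lie bracket on `G` of the left-invariant vector fields of `X` and `Y`. -/
def extendBracket (X Y : ∀ p : M, L.algebroidFiber p) (g : G) : E :=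
  mlieBracket 𝓘(ℝ, E) (fun g ↦ (L.leftExtend X g : TangentSpace 𝓘(ℝ, E) g))
    (fun g ↦ (L.leftExtend Y g : TangentSpace 𝓘(ℝ, E) g)) g

section Bracket

variable [CompleteSpace E] {X Y : ∀ p : M, L.algebroidFiber p}

theorem mulSliceDeriv_lieBracket (hX : L.IsAlgebroidSection X) (hY : L.IsAlgebroidSection Y)
    {a c : G} {q : M} {w : L.FiberModel} (ha : L.src a = q) (h : (q, w) ∈ L.sliceDomain c) :
    L.mulSliceDeriv c a w (lieBracket ℝ (L.sliceField c q X) (L.sliceField c q Y) w) =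
      L.extendBracket X Y (L.mulSlice c a w) := by
  refine mfderiv_lieBracket_of_related (L.contMDiffAt_mulSlice_right (ha ▸ h))
    (L.differentiableAt_sliceField hX h) (L.differentiableAt_sliceField hY h)
    ((L.contMDiffAt_leftExtend_of_isAlgebroidSection hX _).mdifferentiableAt (by simp))
    ((L.contMDiffAt_leftExtend_of_isAlgebroidSection hY _).mdifferentiableAt (by simp)) ?_ ?_
  · filter_upwards [L.eventually_sliceDomain h] with z hz
    exact L.mulSliceDeriv_sliceField X ha hz
  · filter_upwards [L.eventually_sliceDomain h] with z hz
    exact L.mulSliceDeriv_sliceField Y ha hz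

/-- Taking a to be a unit exhibits the bracket as the image of a vector tangent to a slice of a
target fibre. -/
theorem isVert_extendBracket (hX : L.IsAlgebroidSection X) (hY : L.IsAlgebroidSection Y) (g : G) :
    L.IsVert g (L.extendBracket X Y g) := by
  have hg := L.mem_chartDomain g
  have h1 := L.mulSliceDeriv_lieBracket hX hY (L.src_unit (L.tgt g)) (L.mem_sliceDomain hg)
  have h2 := L.isVert_mulSliceDeriv (L.unit_mem_sliceDomain hg)
    (lieBracket ℝ (L.sliceField g (L.tgt g) X) (L.sliceField g (L.tgt g) Y) (L.coord g g))
  rwa [h1, L.mulSlice_unit hg] at h2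

/-- The brackets at b and at ab are images of the same coordinate bracket, under multiplication by a
unit and by a. -/
theorem extendBracket_mul (hX : L.IsAlgebroidSection X) (hY : L.IsAlgebroidSection Y) {a b : G}
    (h : L.src a = L.tgt b) :
    L.extendBracket X Y (L.mul a b) = L.translate b a b (L.extendBracket X Y b) := by
  have hb := L.mem_chartDomain b
  have hs := L.mem_sliceDomain hb
  have h1 := L.mulSliceDeriv_lieBracket hX hY (L.src_unit (L.tgt b)) hs
  have h2 := L.mulSliceDeriv_lieBracket hX hY h hs
  have h3 : L.mulSlice b a (L.coord b b) = L.mul a b := by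
    unfold mulSlice
    rw [h, L.slice_coord hb]
  rw [L.mulSlice_unit hb] at h1
  rw [h3] at h2
  rw [← h1, ← h2]
  have h4 := L.coordDeriv_mulSliceDeriv hs
    (lieBracket ℝ (L.sliceField b (L.tgt b) X) (L.sliceField b (L.tgt b) Y) (L.coord b b))
  rw [L.slice_coord hb] at h4
  exact (congrArg (L.mulSliceDeriv b a (L.coord b b)) h4).symm

theorem bracket_val (hX : L.IsAlgebroidSection X) (hY : L.IsAlgebroidSection Y) (p : M) :
    ((L.bracket X Y p).1 : E) = L.extendBracket X Y (L.unit p) := by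
  have h1 : L.bracket X Y p = ⟨_, L.isVert_extendBracket hX hY (L.unit p)⟩ :=
    dif_pos (L.isVert_extendBracket hX hY (L.unit p))
  exact congrArg Subtype.val h1

theorem leftExtend_bracket (hX : L.IsAlgebroidSection X) (hY : L.IsAlgebroidSection Y) (g : G) :
    ((L.leftExtend (L.bracket X Y) g).1 : E) = L.extendBracket X Y g := by
  rw [L.leftExtend_val _ rfl (L.mem_chartDomain _)]
  have h1 := L.extendBracket_mul hX hY (L.tgt_unit (L.src g)).symm
  rw [L.mul_unit] at h1
  rw [h1]
  exact congrArg _ (L.bracket_val hX hY _)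

end Bracket

end LieGroupoid

/-! ### The exterior derivative on target fibres in slice charts. -/

theorem ContinuousAlternatingMap.differentiableAt_of_apply {P K : Type*} [NormedAddCommGroup P]
    [NormedSpace ℝ P] [NormedAddCommGroup K] [NormedSpace ℝ K] [FiniteDimensional ℝ K] {k : ℕ}
    {η : P → K [⋀^Fin k]→L[ℝ] ℝ} {x : P} (h : ∀ v, DifferentiableAt ℝ (fun z ↦ η z v) x) :
    DifferentiableAt ℝ η x := by
  let β := Module.finBasis ℝ K
  let T : (K [⋀^Fin k]→L[ℝ] ℝ) →L[ℝ] ((Fin k → Fin (Module.finrank ℝ K)) → ℝ) :=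
    ContinuousLinearMap.pi fun r ↦ ContinuousAlternatingMap.apply ℝ K ℝ fun i ↦ β (r i)
  have hT : Function.Injective T := by
    intro a b hab
    refine ContinuousAlternatingMap.toAlternatingMap_injective ?_
    exact β.ext_alternating fun r _ ↦ congrFun hab r
  -- A form is recovered linearly from its values on basis tuples, and this left inverse is
  -- continuous because the target of T is finite-dimensional.
  obtain ⟨S, hS⟩ := T.toLinearMap.exists_leftInverse_of_injective (LinearMap.ker_eq_bot.2 hT)
  have h1 : DifferentiableAt ℝ (fun z ↦ T (η z)) x :=
    differentiableAt_pi.2 fun r ↦ h fun i ↦ β (r i)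
  have h2 := S.toContinuousLinearMap.differentiableAt.comp x h1
  refine h2.congr_of_eventuallyEq (Filter.Eventually.of_forall fun z ↦ ?_)
  exact (congrArg (fun A ↦ A (η z)) hS).symm

namespace LieGroupoid

open VectorField

variable {E E' G M : Type*}
  [NormedAddCommGroup E] [NormedSpace ℝ E] [NormedAddCommGroup E'] [NormedSpace ℝ E']
  [TopologicalSpace G] [ChartedSpace E G] [IsManifold 𝓘(ℝ, E) ∞ G]
  [TopologicalSpace M] [ChartedSpace E' M] [IsManifold 𝓘(ℝ, E') ∞ M]
  (L : LieGroupoid E E' G M)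

variable {k : ℕ} {p : M}

/-- The restriction of `θ` to `t⁻¹(p)`, read in the slice chart at `x`. -/
def chartForm (θ : ∀ g : G, L.vert g [⋀^Fin k]→L[ℝ] ℝ) (x : L.Fiber p) (z : L.FiberModel) :
    L.FiberModel [⋀^Fin k]→L[ℝ] ℝ :=
  formPullback (K := L.FiberModel) (K' := L.FiberModel)
    (extChartAt 𝓘(ℝ, L.FiberModel) x).symm (L.fiberForm θ p) z

theorem chart_symm_val (x : L.Fiber p) {z : L.FiberModel} (h : (p, z) ∈ L.sliceDomain x.1) :
    ((extChartAt 𝓘(ℝ, L.FiberModel) x).symm z).1 = L.slice x.1 p z :=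
  fiberChart_symm_apply x (L.submersionAt x.1) h.2

theorem inclDeriv_chart_symm (x : L.Fiber p) {z : L.FiberModel}
    (h : (p, z) ∈ L.sliceDomain x.1) (u : L.FiberModel) :
    ((L.inclDeriv ((extChartAt 𝓘(ℝ, L.FiberModel) x).symm z)
      (mfderiv 𝓘(ℝ, L.FiberModel) 𝓘(ℝ, L.FiberModel)
        (extChartAt 𝓘(ℝ, L.FiberModel) x).symm z u)).1 : E) =
      L.mulSliceDeriv x.1 (L.unit p) z u := by
  have h0 : (L.src (L.unit p), z) ∈ L.sliceDomain x.1 := by rwa [L.src_unit]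
  have hev : ∀ᶠ y in 𝓝 z, ((extChartAt 𝓘(ℝ, L.FiberModel) x).symm y).1 =
      L.mulSlice x.1 (L.unit p) y := by
    filter_upwards [L.eventually_sliceDomain h] with y hy
    rw [L.chart_symm_val x hy, L.mulSlice_unit_eq_slice hy]
  have h1 : ContMDiffAt 𝓘(ℝ, L.FiberModel) 𝓘(ℝ, L.FiberModel) ∞
      (extChartAt 𝓘(ℝ, L.FiberModel) x).symm z :=
    L.contMDiffAt_toFiber ((L.contMDiffAt_mulSlice_right h0).congr_of_eventuallyEq hev)
  have h2 := HasMFDerivAt.comp z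
    (L.hasMFDerivAt_incl ((extChartAt 𝓘(ℝ, L.FiberModel) x).symm z))
    (h1.mdifferentiableAt (by simp)).hasMFDerivAt
  have h3 := hasMFDerivAt_unique h2
    ((L.hasMFDerivAt_mulSlice h0).congr_of_eventuallyEq hev)
  exact congrArg (fun A ↦ A u) h3

theorem chartForm_apply (θ : ∀ g : G, L.vert g [⋀^Fin k]→L[ℝ] ℝ) (x : L.Fiber p)
    {z : L.FiberModel} (h : (p, z) ∈ L.sliceDomain x.1) {u : Fin k → L.FiberModel}
    {v : Fin k → L.vert (L.mulSlice x.1 (L.unit p) z)}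
    (huv : ∀ i, L.mulSliceDeriv x.1 (L.unit p) z (u i) = (v i).1) :
    L.chartForm θ x z u = θ (L.mulSlice x.1 (L.unit p) z) v :=
  L.form_congr θ ((L.chart_symm_val x h).trans (L.mulSlice_unit_eq_slice h).symm) fun i ↦
    (L.inclDeriv_chart_symm x h (u i)).trans (huv i)

theorem coord_mem_sliceDomain (x : L.Fiber p) : (p, L.coord x.1 x.1) ∈ L.sliceDomain x.1 := by
  have := L.mem_sliceDomain (L.mem_chartDomain x.1)
  rwa [x.2] at this

theorem mulSlice_coord (x : L.Fiber p) :
    L.mulSlice x.1 (L.unit p) (L.coord x.1 x.1) = x.1 := by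
  have := L.mulSlice_unit (L.mem_chartDomain x.1)
  rwa [x.2] at this

/-- Constant vectors in the slice chart correspond to the frame fields, on which θ is smooth. -/
theorem differentiableAt_chartForm [FiniteDimensional ℝ E]
    {θ : ∀ g : G, L.vert g [⋀^Fin k]→L[ℝ] ℝ}
    (hθ : L.SmoothForm (D := E) (fun g : G ↦ g) θ) (x : L.Fiber p) :
    DifferentiableAt ℝ (L.chartForm θ x) (L.coord x.1 x.1) := by
  have := L.finiteDimensional_fiberModel x.1
  have hx := L.coord_mem_sliceDomain x
  have h0 : (L.src (L.unit p), L.coord x.1 x.1) ∈ L.sliceDomain x.1 := by rwa [L.src_unit]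
  refine ContinuousAlternatingMap.differentiableAt_of_apply fun u ↦ ?_
  have h1 := hθ (L.chartDomain x.1) (L.isOpen_chartDomain x.1)
    (fun i g ↦ L.frame x.1 g (u i)) fun i g hg ↦
      (L.contMDiffAt_frame contMDiffAt_id hg (u i)).contMDiffWithinAt
  have hm : L.mulSlice x.1 (L.unit p) (L.coord x.1 x.1) ∈ L.chartDomain x.1 := by
    rw [L.mulSlice_coord x]; exact L.mem_chartDomain x.1
  have h2 := ContMDiffAt.comp (L.coord x.1 x.1)
    (h1.contMDiffAt ((L.isOpen_chartDomain x.1).mem_nhds hm)) (L.contMDiffAt_mulSlice_right h0)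
  refine ((h2.congr_of_eventuallyEq ?_).mdifferentiableAt (by simp)).differentiableAt
  filter_upwards [L.eventually_sliceDomain hx] with z hz
  refine L.chartForm_apply θ x hz fun i ↦ ?_
  have e := L.mulSlice_unit_eq_slice hz
  have hzm : L.mulSlice x.1 (L.unit p) z ∈ L.chartDomain x.1 := by
    rw [e]; exact L.slice_mem hz
  refine Eq.trans ?_ (L.frame_val hzm (u i)).symm
  rw [e, L.tgt_slice hz, L.coord_slice hz]

theorem chartForm_eq {θ : ∀ g : G, L.vert g [⋀^Fin k]→L[ℝ] ℝ} (hθ : L.IsLeftInvariant θ)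
    (x : L.Fiber p) {z : L.FiberModel} (h : (p, z) ∈ L.sliceDomain x.1)
    {u : Fin k → L.FiberModel} {Y : Fin k → ∀ p : M, L.algebroidFiber p}
    (huY : ∀ i, L.mulSliceDeriv x.1 (L.unit p) z (u i) =
      (L.leftExtend (Y i) (L.mulSlice x.1 (L.unit p) z)).1) :
    L.chartForm θ x z u = θ (L.unit (L.src (L.mulSlice x.1 (L.unit p) z)))
      fun i ↦ Y i (L.src (L.mulSlice x.1 (L.unit p) z)) :=
  (L.chartForm_apply θ x h huY).trans (hθ.apply_leftExtend L Y _)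

theorem chartDeriv_leftExtend (X : ∀ p : M, L.algebroidFiber p) (x : L.Fiber p) :
    (mfderiv 𝓘(ℝ, L.FiberModel) 𝓘(ℝ, L.FiberModel) (extChartAt 𝓘(ℝ, L.FiberModel) x) x
      ((L.fiberTangentEquiv x).symm (L.leftExtend X x.1)) : L.FiberModel) =
        L.sliceField x.1 p X (L.coord x.1 x.1) := by
  have h1 : HasMFDerivAt 𝓘(ℝ, L.FiberModel) 𝓘(ℝ, L.FiberModel)
      (extChartAt 𝓘(ℝ, L.FiberModel) x) x _ :=
    HasMFDerivAt.comp x (g := L.coord x.1) (f := fun y : L.Fiber p ↦ y.1)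
      (L.hasMFDerivAt_coord (L.mem_chartDomain x.1)) (L.hasMFDerivAt_incl x)
  have h2 : L.inclDeriv x ((L.fiberTangentEquiv x).symm (L.leftExtend X x.1)) =
      L.leftExtend X x.1 := (L.fiberTangentEquiv x).apply_symm_apply _
  have h3 : L.slice x.1 p (L.coord x.1 x.1) = x.1 := by
    have := L.slice_coord (L.mem_chartDomain x.1)
    rwa [x.2] at this
  unfold sliceField
  rw [h3]
  refine (congrArg (fun A ↦ A ((L.fiberTangentEquiv x).symm (L.leftExtend X x.1)))
    h1.mfderiv).trans ?_
  exact congrArg (fun v : L.vert x.1 ↦ L.coordDeriv x.1 x.1 v.1) h2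

theorem manifoldExtDeriv_fiberForm (θ : ∀ g : G, L.vert g [⋀^Fin k]→L[ℝ] ℝ)
    (X : Fin (k + 1) → ∀ p : M, L.algebroidFiber p) (x : L.Fiber p) :
    manifoldExtDeriv (L.fiberForm θ p) x
        (fun i ↦ (L.fiberTangentEquiv x).symm (L.leftExtend (X i) x.1)) =
      extDeriv (L.chartForm θ x) (L.coord x.1 x.1)
        fun i ↦ L.sliceField x.1 p (X i) (L.coord x.1 x.1) := by
  have h1 : (fun i ↦ L.sliceField x.1 p (X i) (L.coord x.1 x.1)) = _ :=
    funext fun i ↦ (L.chartDeriv_leftExtend (X i) x).symm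
  rw [h1]
  rfl

/-- The slice field maps to X̃, which s_* maps to ρ(X); the rest is the chain rule. -/
theorem fderiv_comp_src_mulSlice {f : M → ℝ} (hf : ContMDiff 𝓘(ℝ, E') 𝓘(ℝ, ℝ) ∞ f)
    (X : ∀ p : M, L.algebroidFiber p) {c : G} {z : L.FiberModel} (h : (p, z) ∈ L.sliceDomain c) :
    fderiv ℝ (fun z ↦ f (L.src (L.mulSlice c (L.unit p) z))) z (L.sliceField c p X z) =
      L.anchorDeriv X f (L.src (L.mulSlice c (L.unit p) z)) := by
  have h0 : (L.src (L.unit p), z) ∈ L.sliceDomain c := by rwa [L.src_unit]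
  have h1 := HasMFDerivAt.comp z (g := f ∘ L.src) (HasMFDerivAt.comp _
    ((hf (L.src (L.mulSlice c (L.unit p) z))).mdifferentiableAt (by simp)).hasMFDerivAt
    (L.hasMFDerivAt_src _)) (L.hasMFDerivAt_mulSlice h0)
  have h2 : HasFDerivAt (fun z ↦ f (L.src (L.mulSlice c (L.unit p) z)))
      (((modelDeriv (K := E') (K' := ℝ) f (L.src (L.mulSlice c (L.unit p) z))).comp
        (L.srcDeriv (L.mulSlice c (L.unit p) z))).comp (L.mulSliceDeriv c (L.unit p) z)) z :=
    hasMFDerivAt_iff_hasFDerivAt.1 h1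
  rw [h2.fderiv]
  change modelDeriv (K := E') (K' := ℝ) f _ (L.srcDeriv _ (L.mulSliceDeriv c (L.unit p) z _)) = _
  rw [L.mulSliceDeriv_sliceField X (L.src_unit p) h]
  exact congrArg (modelDeriv (K := E') (K' := ℝ) f _) (L.srcDeriv_leftExtend X _)

/-! ### Comparison of the two differentials. -/

section Main

variable [FiniteDimensional ℝ E] {θ : ∀ g : G, L.vert g [⋀^Fin k]→L[ℝ] ℝ}

theorem fderiv_chartForm (hθ : L.SmoothForm (D := E) (fun g : G ↦ g) θ)
    (hθ' : L.IsLeftInvariant θ) {X : Fin k → ∀ p : M, L.algebroidFiber p}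
    (hX : ∀ i, L.IsAlgebroidSection (X i)) (Y : ∀ p : M, L.algebroidFiber p) (x : L.Fiber p) :
    fderiv ℝ (fun z ↦ L.chartForm θ x z fun i ↦ L.sliceField x.1 p (X i) z) (L.coord x.1 x.1)
        (L.sliceField x.1 p Y (L.coord x.1 x.1)) =
      L.anchorDeriv Y (fun q ↦ θ (L.unit q) fun i ↦ X i q) (L.src x.1) := by
  have hx := L.coord_mem_sliceDomain x
  have h1 : (fun z ↦ L.chartForm θ x z fun i ↦ L.sliceField x.1 p (X i) z) =ᶠ[𝓝 (L.coord x.1 x.1)]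
      fun z ↦ (fun q ↦ θ (L.unit q) fun i ↦ X i q) (L.src (L.mulSlice x.1 (L.unit p) z)) := by
    filter_upwards [L.eventually_sliceDomain hx] with z hz
    exact L.chartForm_eq hθ' x hz fun i ↦ L.mulSliceDeriv_sliceField (X i) (L.src_unit p) hz
  rw [h1.fderiv_eq]
  have h2 := L.smoothForm_restrict hθ univ isOpen_univ X hX
  rw [contMDiffOn_univ] at h2
  refine (L.fderiv_comp_src_mulSlice h2 Y hx).trans ?_
  rw [L.mulSlice_coord x]

theorem extDeriv_chartForm (hθ : L.SmoothForm (D := E) (fun g : G ↦ g) θ)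
    (hθ' : L.IsLeftInvariant θ) {X : Fin (k + 1) → ∀ p : M, L.algebroidFiber p}
    (hX : ∀ i, L.IsAlgebroidSection (X i)) (x : L.Fiber p) :
    extDeriv (L.chartForm θ x) (L.coord x.1 x.1)
        (fun i ↦ L.sliceField x.1 p (X i) (L.coord x.1 x.1)) =
      L.algebroidDeriv (fun p ↦ θ (L.unit p)) X (L.src x.1) := by
  have hcomplete : CompleteSpace E := FiniteDimensional.complete ℝ E
  have hx := L.coord_mem_sliceDomain x
  have hd := L.differentiableAt_chartForm hθ x
  have hV (i : Fin (k + 1)) := L.differentiableAt_sliceField (hX i) hx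
  have hfirst (i : Fin (k + 1)) := L.fderiv_chartForm hθ hθ' (fun j ↦ hX (i.succAbove j)) (X i) x
  have hsign (m : ℕ) (r : ℝ) : (-1 : ℤ) ^ m • r = (-1 : ℝ) ^ m * r := by simp
  unfold algebroidDeriv
  match k, θ, hθ, hθ', X, hX, hd, hV, hfirst with
  | 0, θ, hθ, hθ', X, hX, hd, hV, hfirst =>
    -- With a single vector field there are no pairs, so the commutation hypothesis is vacuous and
    -- the bracket sum is zero.
    rw [extDeriv_apply_vectorField_of_pairwise_commute hd hV
      (fun i j hij ↦ absurd (Subsingleton.elim (α := Fin 1) i j) hij)]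
    refine Eq.trans ?_ (add_zero _).symm
    refine Finset.sum_congr rfl fun i _ ↦ ?_
    exact (hsign _ _).trans (congrArg ((-1 : ℝ) ^ (i : ℕ) * ·) (hfirst i))
  | n + 1, θ, hθ, hθ', X, hX, hd, hV, hfirst =>
    rw [extDeriv_apply_vectorField hd hV, sub_eq_add_neg]
    refine congrArg₂ (· + ·) (Finset.sum_congr rfl fun i _ ↦
      (hsign _ _).trans (congrArg ((-1 : ℝ) ^ (i : ℕ) * ·) (hfirst i))) ?_
    unfold bracketSum
    rw [← Finset.sum_neg_distrib]
    refine Finset.sum_congr rfl fun i _ ↦ ?_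
    rw [← Finset.sum_neg_distrib]
    refine Finset.sum_congr rfl fun j _ ↦ ?_
    -- The slice bracket goes in the first slot. Its image on G is the left extension of the
    -- algebroid bracket, so invariance moves the whole evaluation to the unit.
    have h1 := L.chartForm_eq hθ' x hx
      (u := Matrix.vecCons (lieBracket ℝ (L.sliceField x.1 p (X i.castSucc))
        (L.sliceField x.1 p (X j.succ)) (L.coord x.1 x.1))
        (j.removeNth (i.castSucc.removeNth fun l ↦ L.sliceField x.1 p (X l) (L.coord x.1 x.1))))
      (Y := Matrix.vecCons (L.bracket (X i.castSucc) (X j.succ))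
        (j.removeNth (i.castSucc.removeNth X))) (by
        refine Fin.cases ?_ fun l ↦ ?_
        · refine (L.mulSliceDeriv_lieBracket (hX _) (hX _) (L.src_unit p) hx).trans ?_
          exact (L.leftExtend_bracket (hX _) (hX _) _).symm
        · exact L.mulSliceDeriv_sliceField _ (L.src_unit p) hx)
    rw [L.mulSlice_coord x] at h1
    -- The index j stands for the field `X j.succ`; this shift by one absorbs the minus sign in
    -- front of the bracket sum.
    rw [h1, hsign, ← neg_mul, ← add_assoc, pow_succ, mul_neg_one]
    refine congrArg (_ * ·) (congrArg _ (funext ?_))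
    exact Fin.cases rfl fun l ↦ rfl

end Main

end LieGroupoid

end

theorem proposition3p3 {E E' G M : Type*}
    [NormedAddCommGroup E] [NormedSpace ℝ E] [FiniteDimensional ℝ E]
    [NormedAddCommGroup E'] [NormedSpace ℝ E'] [FiniteDimensional ℝ E']
    [TopologicalSpace G] [ChartedSpace E G] [IsManifold 𝓘(ℝ, E) ∞ G]
    [TopologicalSpace M] [ChartedSpace E' M] [IsManifold 𝓘(ℝ, E') ∞ M]
    (L : LieGroupoid E E' G M) (k : ℕ) :
    ∃ φ : L.leftInvariantForms k ≃ₗ[ℝ] L.algebroidForms k,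
      (∀ (θ : L.leftInvariantForms k) (p : M), (φ θ).1 p = θ.1 (L.unit p)) ∧
      (∀ X Y : ∀ p : M, L.algebroidFiber p, L.IsAlgebroidSection X → L.IsAlgebroidSection Y →
        ∀ p : M, (L.bracket X Y p : TangentSpace 𝓘(ℝ, E) (L.unit p)) =
          VectorField.mlieBracket 𝓘(ℝ, E)
            (fun g ↦ (L.leftExtend X g : TangentSpace 𝓘(ℝ, E) g))
            (fun g ↦ (L.leftExtend Y g : TangentSpace 𝓘(ℝ, E) g)) (L.unit p)) ∧
      ∀ (θ : L.leftInvariantForms k) (X : Fin (k + 1) → ∀ p : M, L.algebroidFiber p),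
        (∀ i, L.IsAlgebroidSection (X i)) →
        ∀ (p : M) (g : L.Fiber p),
          manifoldExtDeriv (L.fiberForm θ.1 p) g
              (fun i ↦ (L.fiberTangentEquiv g).symm (L.leftExtend (X i) g.1)) =
            L.algebroidDeriv (φ θ).1 X (L.src g.1) := by
  have hcomplete : CompleteSpace E := FiniteDimensional.complete ℝ E
  exact ⟨L.restrictEquiv k, fun θ p ↦ rfl, fun X Y hX hY p ↦ L.bracket_val hX hY p,
    fun θ X hX p g ↦ (L.manifoldExtDeriv_fiberForm θ.1 X g).trans
      (L.extDeriv_chartForm θ.2.1 θ.2.2 hX g)⟩
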